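/- Let $\mathscr{L}=\{\ell_j\}_{j\in[n]}$ be a sequence of lines (one-dimensional subspaces) in $\mathbb{C}^d$ that is linearly dependent, i.e. one of the lines is contained in the span of the others, and assume that the lines $\ell_j$ are not all equal. Let $\operatorname{Aut}\mathscr{L}\le S_n$ be the group of all permutations $\sigma$ for which there is a unitary $U$ of $\mathbb{C}^d$ with $U\ell_j=\ell_{\sigma(j)}$ for all $j\in[n]$; $\mathscr{L}$ is called doubly transitive if for all $i\neq j$ and $k\neq l$ in $[n]$ some $\sigma\in\operatorname{Aut}\mathscr{L}$ satisfies $\sigma(i)=k$, $\sigma(j)=l$. For $r\ge 1$ let $C_r$ be the group of complex $r$-th roots of unity. Then $\mathscr{L}$ is doubly transitive if and only if the following three conditions hold simultaneously: (a) $\mathscr{L}$ is equiangular: $|\langle\varphi_i,\varphi_j\rangle|$ has the same value $\mu$ for all $i\ne j$ and all unit vectors $\varphi_i\in\ell_i$, $\varphi_j\in\ell_j$; and there are an integer $r\ge 1$ and unit vectors $\varphi_j\in\ell_j$ $(j\in[n])$, with matrix $\Phi=[\varphi_1\cdots\varphi_n]$, such that (b) the off-diagonal entries of the signature matrix $\mu^{-1}(\Phi^*\Phi-I)$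 are $r$-th roots of unity (here $\mu\neq0$ is the common modulus from (a)), and (c) the Gram matrix $\mathcal{G}$ of $\{z\varphi_j\}_{j\in[n],\,z\in C_r}$ carries a Schurian association scheme. Moreover, if (a) holds, then for every $r\ge1$ and every choice of unit vectors $\varphi_j\in\ell_j$ that satisfy (b) and (c), there is a Higman pair $(G,H)$ such that, after identifying $[n]\times C_r$ with $G/H$ by a suitable bijection, $\mathcal{G}$ carries the Schurian scheme of $G$ acting on $G/H$, this scheme is commutative, and a scalar multiple of $\mathcal{G}$ is a primitive idempotent of this scheme. Definitions. An association scheme on a finite set $X$ is a finite family of nonzero matrices $A_i\in\{0,1\}^{X\times X}$, one of which is $I$, with $\sum_iA_i=J$ (the all-ones matrix), such that $\mathscr{A}=\operatorname{span}_{\mathbb{C}}\{A_i\}$ is closed under multiplication and conjugate transposition ($\mathscr{A}$ is the adjacency algebra; the scheme is commutative if $\mathscr{A}$ is). A matrix carries the scheme if it equals $\sum_ic_iA_i$ with pairwise distinct $c_i\in\mathbb{C}$. The Schurian scheme of a transitive action of a finite group $G$ on a nonempty finite set $X$ consists of the indicator matrices of the orbits of $G$ on $X\times X$. A primitive idempotent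 of a commutative scheme is a nonzero orthogonal projection $P\in\mathscr{A}$ such that every orthogonal projection $Q\in\mathscr{A}$ with $PQ=Q$ is $0$ or $P$. A pair $(G,H)$ of a finite group $G$ and a proper subgroup $H$, with normalizer $K=N_G(H)$, is a Higman pair if there is $b\in G\setminus K$ such that $G$ acts doubly transitively on $G/K$; $K/H$ is abelian; $HbH=Hb^{-1}H$; $aba^{-1}\in HbH$ for every $a\in K$; and $a\in K$ with $ab\in HbH$ implies $a\in H$. -/

import Mathlib

open scoped Matrix

namespace LineSystem

/-! ### Sequences of lines in a finite-dimensional complex inner product space -/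

/-- One of the lines is contained in the span of the others. -/
def IsLinearlyDependent {d n : ℕ}
    (L : Fin n → Submodule ℂ (EuclideanSpace ℂ (Fin d))) : Prop :=
  ∃ i, L i ≤ ⨆ j : {j : Fin n // j ≠ i}, L j

/-- The automorphism group of a sequence of lines: all permutations of the sequence that can be
realized by applying a unitary operator. -/
def autGroup {d n : ℕ} (L : Fin n → Submodule ℂ (EuclideanSpace ℂ (Fin d))) :
    Subgroup (Equiv.Perm (Fin n)) where
  carrier := {σ | ∃ U : EuclideanSpace ℂ (Fin d) ≃ₗᵢ[ℂ] EuclideanSpace ℂ (Fin d),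
    ∀ i, (L i).map (U.toLinearEquiv : EuclideanSpace ℂ (Fin d) →ₗ[ℂ] _) = L (σ i)}
  one_mem' := ⟨LinearIsometryEquiv.refl ℂ _, fun i => by
    ext x; simp⟩
  mul_mem' := by
    rintro σ τ ⟨U, hU⟩ ⟨V, hV⟩
    refine ⟨V.trans U, fun i => ?_⟩
    rw [Equiv.Perm.mul_apply, ← hU, ← hV]
    ext x
    simp
  inv_mem' := by
    rintro σ ⟨U, hU⟩
    refine ⟨U.symm, fun i => ?_⟩
    have h : _ = L i := (hU (σ⁻¹ i)).trans (congrArg L (σ.apply_symm_apply i))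
    rw [← h]
    ext x
    simp

/-- The automorphism group acts doubly transitively on the sequence of lines. -/
def IsDoublyTransitive {d n : ℕ}
    (L : Fin n → Submodule ℂ (EuclideanSpace ℂ (Fin d))) : Prop :=
  ∀ i j k l : Fin n, i ≠ j → k ≠ l → ∃ σ ∈ autGroup L, σ i = k ∧ σ j = l

/-- `φ` is a choice of unit-norm representatives of the lines in `L`. -/
def IsUnitRepresentatives {d n : ℕ} (L : Fin n → Submodule ℂ (EuclideanSpace ℂ (Fin d)))
    (φ : Fin n → EuclideanSpace ℂ (Fin d)) : Prop :=
  ∀ i, φ i ∈ L i ∧ ‖φ i‖ = 1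

/-- There is a constant that is the modulus of the inner product of any two unit-norm
representatives of any two lines (with different indices) of the sequence. -/
def IsEquiangular {d n : ℕ} (L : Fin n → Submodule ℂ (EuclideanSpace ℂ (Fin d))) : Prop :=
  ∃ μ : ℝ, ∀ φ, IsUnitRepresentatives L φ → ∀ i j, i ≠ j → ‖inner ℂ (φ i) (φ j)‖ = μ

/-- `S = μ⁻¹ (Φ* Φ - I)`, where `μ ≠ 0` is the common modulus of the off-diagonal entries of the
Gram matrix `Φ* Φ`. -/
def IsSignatureMatrixOf {d n : ℕ} (S : Matrix (Fin n) (Fin n) ℂ)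
    (φ : Fin n → EuclideanSpace ℂ (Fin d)) : Prop :=
  ∃ μ : ℝ, μ ≠ 0 ∧ (∀ i j, i ≠ j → ‖inner ℂ (φ i) (φ j)‖ = μ) ∧
    S = (μ : ℂ)⁻¹ • (Matrix.gram ℂ φ - 1)

/-- The off-diagonal entries of the signature matrix of `φ` are `r`-th roots of unity
(the diagonal entries of a signature matrix are always `0`). -/
def HasRootsOfUnitySignature {d n : ℕ} (φ : Fin n → EuclideanSpace ℂ (Fin d)) (r : ℕ) : Prop :=
  ∃ S : Matrix (Fin n) (Fin n) ℂ, IsSignatureMatrixOf S φ ∧ ∀ i j, i ≠ j → S i j ^ r = 1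

/-- The Gram matrix of the system of all multiples `z φ_j` with `z` in the group `C_r` of `r`-th
roots of unity. -/
noncomputable def multiplesGram {d n : ℕ} (φ : Fin n → EuclideanSpace ℂ (Fin d)) (r : ℕ) :
    Matrix (Fin n × rootsOfUnity r ℂ) (Fin n × rootsOfUnity r ℂ) ℂ :=
  Matrix.gram ℂ fun p : Fin n × rootsOfUnity r ℂ => ((p.2 : ℂˣ) : ℂ) • φ p.1

/-! ### Association schemes -/

/-- An association scheme on the finite set `X` (not necessarily commutative or symmetric). -/
structure AssociationScheme (X : Type*) [Fintype X] where
  /-- The set that indexes the adjacency matrices. -/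
  Index : Type*
  [fintypeIndex : Fintype Index]
  /-- The adjacency matrices. -/
  A : Index → Matrix X X ℂ
  zero_or_one : ∀ i x y, A i x y = 0 ∨ A i x y = 1
  ne_zero : ∀ i, A i ≠ 0
  /-- One of the (zero-one) adjacency matrices is the identity matrix. -/
  exists_identity : ∃ i, ∀ x y, A i x y = 1 ↔ x = y
  /-- The adjacency matrices sum to the all-ones matrix. -/
  sum_eq : ∑ i, A i = Matrix.of fun _ _ => 1
  mul_mem : ∀ M ∈ Submodule.span ℂ (Set.range A), ∀ N ∈ Submodule.span ℂ (Set.range A),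
    M * N ∈ Submodule.span ℂ (Set.range A)
  star_mem : ∀ M ∈ Submodule.span ℂ (Set.range A), Mᴴ ∈ Submodule.span ℂ (Set.range A)

namespace AssociationScheme

attribute [instance] AssociationScheme.fintypeIndex

variable {X : Type*} [Fintype X]

/-- The adjacency algebra of a scheme, as a space of matrices. -/
def adjacencyAlgebra (S : AssociationScheme X) : Submodule ℂ (Matrix X X ℂ) :=
  Submodule.span ℂ (Set.range S.A)

/-- The adjacency algebra is commutative. -/
def IsCommutative (S : AssociationScheme X) : Prop :=
  ∀ M ∈ S.adjacencyAlgebra, ∀ N ∈ S.adjacencyAlgebra, M * N = N * M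

/-- `M` carries the scheme: it is a combination of the adjacency matrices with pairwise distinct
coefficients. -/
def IsCarriedBy (S : AssociationScheme X) (M : Matrix X X ℂ) : Prop :=
  ∃ c : S.Index → ℂ, Function.Injective c ∧ M = ∑ i, c i • S.A i

/-- For a commutative scheme: `P` is a nonzero orthogonal projection in the adjacency algebra
that dominates no orthogonal projection of the adjacency algebra except `0` and itself. -/
def IsPrimitiveIdempotent (S : AssociationScheme X) (P : Matrix X X ℂ) : Prop :=
  P ∈ S.adjacencyAlgebra ∧ IsStarProjection P ∧ P ≠ 0 ∧
    ∀ Q ∈ S.adjacencyAlgebra, IsStarProjection Q → P * Q = Q → Q = 0 ∨ Q = P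

end AssociationScheme

/-! ### Schurian schemes -/

section Schurian

variable (G X : Type*) [Group G] [MulAction G X]

open Classical in
/-- The indicator matrix of an orbit of `G` acting diagonally on `X × X`. -/
noncomputable def orbitMatrix (q : MulAction.orbitRel.Quotient G (X × X)) : Matrix X X ℂ :=
  Matrix.of fun x y =>
    if (Quotient.mk (MulAction.orbitRel G (X × X)) (x, y)) = q then 1 else 0

lemma mk_eq_mk_iff (x y x' y' : X) :
    (Quotient.mk (MulAction.orbitRel G (X × X)) (x, y)) =
      Quotient.mk (MulAction.orbitRel G (X × X)) (x', y') ↔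
      ∃ g : G, g • x' = x ∧ g • y' = y := by
  rw [Quotient.eq, MulAction.orbitRel_apply, MulAction.mem_orbit_iff]
  simp [Prod.ext_iff]

/-- The span of the orbit matrices consists of the `G`-stable matrices. -/
lemma mem_span_orbitMatrix_iff [Finite X] (M : Matrix X X ℂ) :
    M ∈ Submodule.span ℂ (Set.range (orbitMatrix G X)) ↔
      ∀ (g : G) (x y : X), M (g • x) (g • y) = M x y := by
  classical
  constructor
  · intro h g x y
    induction h using Submodule.span_induction with
    | mem m hm =>
      obtain ⟨q, rfl⟩ := hm
      have : (Quotient.mk (MulAction.orbitRel G (X × X)) (g • x, g • y)) =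
          Quotient.mk (MulAction.orbitRel G (X × X)) (x, y) :=
        (mk_eq_mk_iff G X _ _ _ _).2 ⟨g, rfl, rfl⟩
      simp [orbitMatrix, this]
    | zero => simp
    | add a b _ _ ha hb => simp [ha, hb]
    | smul c a _ ha => simp [ha]
  · intro h
    have : Fintype (MulAction.orbitRel.Quotient G (X × X)) := Fintype.ofFinite _
    let c : MulAction.orbitRel.Quotient G (X × X) → ℂ :=
      Quotient.lift (fun p : X × X => M p.1 p.2) (by
        rintro ⟨a, b⟩ ⟨a', b'⟩ hab
        obtain ⟨g, h1, h2⟩ := (mk_eq_mk_iff G X a b a' b').1 (Quotient.sound hab)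
        simp only
        rw [← h1, ← h2, h])
    have hM : M = ∑ q, c q • orbitMatrix G X q := by
      ext x y
      simp only [Matrix.sum_apply, Matrix.smul_apply, orbitMatrix, Matrix.of_apply, smul_eq_mul,
        mul_ite, mul_one, mul_zero, Finset.sum_ite_eq, Finset.mem_univ, if_true]
      rfl
    rw [hM]
    exact Submodule.sum_mem _ fun q _ =>
      Submodule.smul_mem _ _ (Submodule.subset_span ⟨q, rfl⟩)

open Classical in
/-- The Schurian scheme of a transitive action of the group `G` on the nonempty finite set `X`:
its adjacency matrices are the indicator matrices of the orbits of `G` on `X × X`. -/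
noncomputable def schurianScheme [Fintype X] [Nonempty X] [MulAction.IsPretransitive G X] :
    AssociationScheme X where
  Index := MulAction.orbitRel.Quotient G (X × X)
  fintypeIndex := Fintype.ofFinite _
  A := orbitMatrix G X
  zero_or_one q x y := by
    simp only [orbitMatrix, Matrix.of_apply]
    split_ifs <;> simp
  ne_zero q h := by
    induction q using Quotient.inductionOn with
    | h p => simpa [orbitMatrix] using congrFun (congrFun h p.1) p.2
  exists_identity := by
    obtain ⟨x₀⟩ := ‹Nonempty X›
    refine ⟨Quotient.mk _ (x₀, x₀), fun x y => ?_⟩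
    have : orbitMatrix G X (Quotient.mk _ (x₀, x₀)) x y = 1 ↔
        (Quotient.mk (MulAction.orbitRel G (X × X)) (x, y)) = Quotient.mk _ (x₀, x₀) := by
      simp [orbitMatrix]
    rw [this, mk_eq_mk_iff]
    constructor
    · rintro ⟨g, rfl, rfl⟩
      rfl
    · rintro rfl
      obtain ⟨g, hg⟩ := MulAction.exists_smul_eq G x₀ x
      exact ⟨g, hg, hg⟩
  sum_eq := by
    ext x y
    simp [Matrix.sum_apply, orbitMatrix]
  mul_mem M hM N hN := by
    rw [mem_span_orbitMatrix_iff] at *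
    intro g x y
    rw [Matrix.mul_apply, Matrix.mul_apply, ← Equiv.sum_comp (MulAction.toPerm g)]
    simp [hM, hN]
  star_mem M hM := by
    rw [mem_span_orbitMatrix_iff] at *
    intro g x y
    simp [Matrix.conjTranspose_apply, hM]

end Schurian

/-- `M` carries the Schurian scheme of some transitive action of a finite group on the nonempty
finite set `X`. -/
def CarriesSchurianScheme {X : Type*} (M : Matrix X X ℂ) : Prop :=
  ∃ (_ : Fintype X) (_ : Nonempty X) (G : Type) (_ : Group G) (_ : Finite G) (_ : MulAction G X)
    (_ : MulAction.IsPretransitive G X), (schurianScheme G X).IsCarriedBy M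

/-! ### Higman pairs -/

/-- `b` is a key for `(G, H)`; here `K = N_G(H)`. -/
structure IsHigmanKey {G : Type*} [Group G] (H : Subgroup G) (b : G) : Prop where
  notMem : b ∉ Subgroup.normalizer (H : Set G)
  doublyTransitive :
    MulAction.IsMultiplyPretransitive G (G ⧸ Subgroup.normalizer (H : Set G)) 2
  /-- The quotient group `K / H` is abelian. -/
  comm : ∀ u v : (Subgroup.normalizer (H : Set G)) ⧸
    H.subgroupOf (Subgroup.normalizer (H : Set G)), u * v = v * u
  inv_eq : DoubleCoset.doubleCoset b (H : Set G) H = DoubleCoset.doubleCoset b⁻¹ (H : Set G) H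
  conj_mem : ∀ a ∈ Subgroup.normalizer (H : Set G),
    a * b * a⁻¹ ∈ DoubleCoset.doubleCoset b (H : Set G) H
  mem_of_mul_mem : ∀ a ∈ Subgroup.normalizer (H : Set G),
    a * b ∈ DoubleCoset.doubleCoset b (H : Set G) H → a ∈ H

/-- `(G, H)` is a Higman pair: `G` is a finite group, `H` is a proper subgroup, and there is a
key. -/
def IsHigmanPair (G : Type*) [Group G] (H : Subgroup G) : Prop :=
  Finite G ∧ H ≠ ⊤ ∧ ∃ b : G, IsHigmanKey H b

end LineSystem

/-! Everything is read off the Gram matrix `M` of the vectors `z φ_j` and its full automorphism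
group `matrixAut M`. For such `M`, carrying a Schurian scheme amounts to `IsLevelTransitive M`. The
matrix remembers the geometry: an entry of modulus 1 means "same line", and an entry equal to a root
`z` means "rotated by `z`". Hence automorphisms permute the lines and commute with the phase
rotations.

Level transitivity gives double transitivity: any two distinct lines contain vectors with inner
product `μ`, so an automorphism moves any pair of distinct lines to any other, and equality of Gram
matrices makes it unitary (`exists_linearIsometryEquiv`).

Conversely, a unitary symmetry multiplies representatives by phases. Scaled to have product 1, its
phase at a fixed line is a root of unity of order dividing `n! * n`
(`IsMonomialSymmetry.pow_eq_one`). Transporting a representative from one base line to all others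
makes every relevant phase such a root (`IsMonomialSymmetry.exists_phases`). A symmetry that swaps
two lines then controls the square of a signature entry, whence `r = 2 * (n! * n)`.

For the Higman pair, `G = matrixAut M` and `H` is a point stabilizer, whose normalizer is the line
stabilizer because `n ≥ 3`. The scheme is commutative since rotations are central and the product of
two other orbit matrices depends only on the product of their phases. The phase-equivariant stable
matrices are spanned by `M` and its block diagonal part; a linear relation among the lines gives a
kernel vector of `M`, which forces `M * M = b • M` and makes `b⁻¹ • M` a primitive idempotent. -/

namespace LineSystem

/-! ### Root Gram matrices, phase rotations and automorphisms -/

section RootGram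

variable {n r : ℕ}

/-- The phase rotation by a root of unity. -/
def rot (z : rootsOfUnity r ℂ) : Equiv.Perm (Fin n × rootsOfUnity r ℂ) :=
  (Equiv.refl _).prodCongr (Equiv.mulLeft z)

@[simp] lemma rot_apply (z : rootsOfUnity r ℂ) (x : Fin n × rootsOfUnity r ℂ) :
    rot z x = (x.1, z * x.2) := rfl

lemma rot_mul (z w : rootsOfUnity r ℂ) (x : Fin n × rootsOfUnity r ℂ) :
    rot (z * w) x = rot z (rot w x) := by simp [mul_assoc]

lemma exists_eq_rot {x y : Fin n × rootsOfUnity r ℂ} (h : x.1 = y.1) : ∃ z, y = rot z x :=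
  ⟨y.2 * x.2⁻¹, by ext1 <;> simp [h]⟩

/-- A Gram matrix, up to the factor `μ` off the lines a matrix of `r`-th roots of unity, of a
system of vectors that is stable under multiplication by `r`-th roots of unity. -/
structure IsRootGram (μ : ℝ) (M : Matrix (Fin n × rootsOfUnity r ℂ) (Fin n × rootsOfUnity r ℂ) ℂ) :
    Prop where
  pos : 0 < μ
  lt_one : μ < 1
  apply_rot : ∀ x y z, M x (rot z y) = ((z : ℂˣ) : ℂ) * M x y
  conj_apply : ∀ x y, star (M x y) = M y x
  apply_self : ∀ x, M x x = 1
  exists_phase : ∀ x y, x.1 ≠ y.1 → ∃ z : rootsOfUnity r ℂ, M x y = μ * ((z : ℂˣ) : ℂ)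

/-- The permutations that preserve a matrix. -/
def matrixAut {X : Type*} (M : Matrix X X ℂ) : Subgroup (Equiv.Perm X) where
  carrier := {g | ∀ x y, M (g x) (g y) = M x y}
  one_mem' _ _ := rfl
  mul_mem' {g h} hg hh x y := by
    rw [Equiv.Perm.mul_apply, Equiv.Perm.mul_apply, hg, hh]
  inv_mem' {g} hg x y := by
    rw [← hg]; simp

/-- Equal entries of the matrix are in the same orbit of its automorphism group. -/
def IsLevelTransitive {X : Type*} (M : Matrix X X ℂ) : Prop :=
  ∀ x y x' y', M x y = M x' y' → ∃ g : matrixAut M, g • x = x' ∧ g • y = y'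

lemma matrixAut_apply {X : Type*} {M : Matrix X X ℂ} (g : matrixAut M) (x y : X) :
    M (g • x) (g • y) = M x y := g.2 x y

/-- A matrix carries a Schurian scheme if the orbits are the sets on which it is constant. -/
lemma isCarriedBy_schurianScheme {G X : Type*} [Group G] [MulAction G X] [Fintype X] [Nonempty X]
    [MulAction.IsPretransitive G X] {M : Matrix X X ℂ} (hM : ∀ (g : G) x y, M (g • x) (g • y) = M x y)
    (h : ∀ x y x' y', M x y = M x' y' → ∃ g : G, g • x' = x ∧ g • y' = y) :
    (schurianScheme G X).IsCarriedBy M := by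
  classical
  let c : MulAction.orbitRel.Quotient G (X × X) → ℂ :=
    Quotient.lift (fun p : X × X => M p.1 p.2) (by
      rintro ⟨a, b⟩ ⟨a', b'⟩ hab
      obtain ⟨g, h1, h2⟩ := (mk_eq_mk_iff G X a b a' b').1 (Quotient.sound hab)
      simp only
      rw [← h1, ← h2, hM])
  refine ⟨c, ?_, ?_⟩
  · intro p q
    induction p using Quotient.inductionOn with | h p => ?_
    induction q using Quotient.inductionOn with | h q => ?_
    intro hpq
    exact (mk_eq_mk_iff G X p.1 p.2 q.1 q.2).2 (h _ _ _ _ hpq)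
  · ext x y
    simp only [schurianScheme, Matrix.sum_apply, Matrix.smul_apply, orbitMatrix, Matrix.of_apply,
      smul_eq_mul, mul_ite, mul_one, mul_zero]
    rw [Finset.sum_eq_single (Quotient.mk (MulAction.orbitRel G (X × X)) (x, y))]
    · simp [c]
    · intro b _ hb
      rw [if_neg (Ne.symm hb)]
    · exact fun hn => absurd (@Finset.mem_univ _ (schurianScheme G X).fintypeIndex _) hn

/-- Distinct coefficients make level sets equal to `G`-orbits, and `G` acts through `matrixAut M`.
This replaces an unknown group by the full automorphism group. -/
lemma CarriesSchurianScheme.isLevelTransitive {X : Type*} {M : Matrix X X ℂ}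
    (h : CarriesSchurianScheme M) : IsLevelTransitive M := by
  classical
  obtain ⟨_, _, G, _, _, _, _, c, hc, hM⟩ := h
  have key : ∀ x y, M x y = c (Quotient.mk (MulAction.orbitRel G (X × X)) (x, y)) := by
    intro x y
    simp only [hM, schurianScheme, Matrix.sum_apply, Matrix.smul_apply, orbitMatrix,
      Matrix.of_apply, smul_eq_mul, mul_ite, mul_one, mul_zero]
    rw [Finset.sum_eq_single (Quotient.mk (MulAction.orbitRel G (X × X)) (x, y))]
    · simp
    · intro b _ hb
      rw [if_neg (Ne.symm hb)]
    · exact fun hn => absurd (@Finset.mem_univ _ (schurianScheme G X).fintypeIndex _) hn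
  intro x y x' y' hxy
  rw [key, key] at hxy
  obtain ⟨g, h1, h2⟩ := (mk_eq_mk_iff G X _ _ _ _).1 (hc hxy.symm)
  refine ⟨⟨MulAction.toPerm g, fun u v => ?_⟩, h1, h2⟩
  rw [key, key]
  congr 1
  exact (mk_eq_mk_iff G X _ _ _ _).2 ⟨g, rfl, rfl⟩

namespace IsRootGram

variable {μ : ℝ} {M : Matrix (Fin n × rootsOfUnity r ℂ) (Fin n × rootsOfUnity r ℂ) ℂ}

lemma norm_root [NeZero r] (z : rootsOfUnity r ℂ) : ‖((z : ℂˣ) : ℂ)‖ = 1 :=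
  Complex.norm_eq_one_of_mem_rootsOfUnity z.2

lemma star_mul_root [NeZero r] (z : rootsOfUnity r ℂ) :
    star ((z : ℂˣ) : ℂ) * ((z : ℂˣ) : ℂ) = 1 := by
  rw [Complex.star_def, Complex.conj_mul', norm_root]; simp

lemma root_injective : Function.Injective fun z : rootsOfUnity r ℂ => ((z : ℂˣ) : ℂ) :=
  Units.val_injective.comp Subtype.val_injective

lemma rot_apply_left (h : IsRootGram μ M) (x y z) :
    M (rot z x) y = star ((z : ℂˣ) : ℂ) * M x y := by
  rw [← h.conj_apply, h.apply_rot, star_mul', h.conj_apply]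

lemma apply_rot_self (h : IsRootGram μ M) (x z) : M x (rot z x) = ((z : ℂˣ) : ℂ) := by
  rw [h.apply_rot, h.apply_self, mul_one]

lemma exists_rot_apply (h : IsRootGram μ M) {x y} (hxy : x.1 ≠ y.1) : ∃ z, M x (rot z y) = μ := by
  obtain ⟨z, hz⟩ := h.exists_phase x y hxy
  refine ⟨z⁻¹, ?_⟩
  rw [h.apply_rot, hz, mul_left_comm, InvMemClass.coe_inv, Units.inv_mul, mul_one]

lemma swap_apply (h : IsRootGram μ M) {x y} (hxy : M x y = μ) : M y x = μ := by
  rw [← h.conj_apply, hxy]; simp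

lemma isPretransitive (h : IsRootGram μ M) (ht : IsLevelTransitive M) :
    MulAction.IsPretransitive (matrixAut M) (Fin n × rootsOfUnity r ℂ) :=
  ⟨fun x y => by
    obtain ⟨g, hg, -⟩ := ht x x y y (by rw [h.apply_self, h.apply_self])
    exact ⟨g, hg⟩⟩

lemma exists_third {n : ℕ} (hn : 3 ≤ n) (i j : Fin n) : ∃ k, k ≠ i ∧ k ≠ j := by
  have : ({i, j} : Finset (Fin n)).card < Fintype.card (Fin n) := by
    rw [Fintype.card_fin]
    exact lt_of_le_of_lt Finset.card_le_two hn
  obtain ⟨k, hk⟩ := Finset.exists_mem_notMem_of_card_lt_card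
    (s := {i, j}) (t := Finset.univ) this
  exact ⟨k, by simpa using hk⟩

variable [NeZero r]

lemma rot_apply_rot (h : IsRootGram μ M) (x y z) : M (rot z x) (rot z y) = M x y := by
  rw [h.apply_rot, h.rot_apply_left, mul_left_comm, ← mul_assoc, star_mul_root, one_mul]

/-- Phase rotations as automorphisms. -/
def rotAut (h : IsRootGram μ M) (z : rootsOfUnity r ℂ) : matrixAut M :=
  ⟨rot z, fun x y => h.rot_apply_rot x y z⟩

@[simp] lemma rotAut_smul (h : IsRootGram μ M) (z : rootsOfUnity r ℂ)
    (x : Fin n × rootsOfUnity r ℂ) :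
    h.rotAut z • x = rot z x := rfl

/-- The lines are visible in `M` because `μ < 1`; this is why automorphisms permute them. -/
lemma line_eq_iff (h : IsRootGram μ M) (x y) : x.1 = y.1 ↔ ‖M x y‖ = 1 := by
  constructor
  · intro hxy
    obtain ⟨z, rfl⟩ := exists_eq_rot hxy
    rw [h.apply_rot_self, norm_root]
  · intro hxy
    by_contra hne
    obtain ⟨z, hz⟩ := h.exists_phase x y hne
    rw [hz, norm_mul, norm_root, mul_one, Complex.norm_real, Real.norm_of_nonneg h.pos.le] at hxy
    exact h.lt_one.ne hxy

lemma line_smul_iff (h : IsRootGram μ M) (g : matrixAut M) (x y : Fin n × rootsOfUnity r ℂ) :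
    (g • x).1 = (g • y).1 ↔ x.1 = y.1 := by
  rw [h.line_eq_iff, h.line_eq_iff, matrixAut_apply g]

lemma eq_rot_of_apply (h : IsRootGram μ M) {x y} {z : rootsOfUnity r ℂ}
    (hxy : M x y = ((z : ℂˣ) : ℂ)) : y = rot z x := by
  obtain ⟨w, rfl⟩ := exists_eq_rot ((h.line_eq_iff x y).2 (by rw [hxy, norm_root]))
  rw [h.apply_rot_self] at hxy
  rw [root_injective hxy]

/-- Rotation by `z` is determined by the entry `M x (rot z x) = z`, which automorphisms preserve. -/
lemma smul_rot (h : IsRootGram μ M) (g : matrixAut M) (z)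
    (x : Fin n × rootsOfUnity r ℂ) : g • rot z x = rot z (g • x) := by
  apply h.eq_rot_of_apply
  rw [matrixAut_apply g, h.apply_rot_self]

lemma line_ne_of_apply (h : IsRootGram μ M) {x y} (hxy : M x y = μ) : x.1 ≠ y.1 := by
  rw [Ne, h.line_eq_iff, hxy, Complex.norm_real, Real.norm_of_nonneg h.pos.le]
  exact h.lt_one.ne

/-! ### The Higman pair -/

/-- The normalizer of a point stabilizer is the stabilizer of the line through the point. -/
lemma mem_normalizer_stabilizer (h : IsRootGram μ M) (ht : IsLevelTransitive M) (hn : 3 ≤ n)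
    (x : Fin n × rootsOfUnity r ℂ) (g : matrixAut M) :
    g ∈ Subgroup.normalizer (MulAction.stabilizer (matrixAut M) x : Set (matrixAut M)) ↔
      (g • x).1 = x.1 := by
  rw [Subgroup.mem_normalizer_iff]
  constructor
  · intro hg
    by_contra hne
    -- A normalizing `g` would make every element of the stabilizer of `x` fix `g • x` too. But some
    -- element fixing `x` moves the line of `g • x` to a third line.
    obtain ⟨k, hk, hk'⟩ := exists_third hn x.1 (g • x).1
    obtain ⟨z, hz⟩ := h.exists_rot_apply (x := x) (y := g • x) (Ne.symm hne)
    obtain ⟨w, hw⟩ := h.exists_rot_apply (x := x) (y := (k, 1)) hk.symm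
    obtain ⟨s, hs1, hs2⟩ := ht _ _ _ _ (hz.trans hw.symm)
    have hs : s ∈ MulAction.stabilizer (matrixAut M) x := hs1
    have h1 := (hg (g⁻¹ * s * g)).2 (by simpa [mul_assoc] using hs)
    rw [MulAction.mem_stabilizer_iff, mul_smul, mul_smul, inv_smul_eq_iff] at h1
    rw [h.smul_rot, h1] at hs2
    exact hk' (congrArg Prod.fst hs2).symm
  · intro hg
    obtain ⟨z, hz⟩ := exists_eq_rot hg.symm
    intro s
    simp only [MulAction.mem_stabilizer_iff]
    have hinv : g⁻¹ • x = rot z⁻¹ x := by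
      rw [inv_smul_eq_iff, h.smul_rot, hz, ← rot_mul]
      simp
    rw [mul_smul, mul_smul, hinv, h.smul_rot, h.smul_rot]
    constructor
    · intro hs
      rw [hs, hz, ← rot_mul]; simp
    · intro hs
      have : rot z⁻¹ (g • s • x) = rot z⁻¹ (rot z x) := by
        rw [hs, ← rot_mul]; simp
      have := (rot (n := n) z⁻¹).injective this
      rw [← hz] at this
      exact MulAction.injective g this

-- Double cosets of a point stabilizer correspond to its orbits on points, which level transitivity
-- identifies with level sets of the row of `x`. The Higman axioms thereby become identities between
-- entries of `M`.
omit [NeZero r] in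
lemma mem_doubleCoset_stabilizer_iff (ht : IsLevelTransitive M) (x : Fin n × rootsOfUnity r ℂ)
    (b g : matrixAut M) :
    g ∈ DoubleCoset.doubleCoset b (MulAction.stabilizer (matrixAut M) x : Set (matrixAut M))
      (MulAction.stabilizer (matrixAut M) x) ↔ M x (g • x) = M x (b • x) := by
  rw [DoubleCoset.mem_doubleCoset]
  constructor
  · rintro ⟨s, hs, t, ht, rfl⟩
    rw [SetLike.mem_coe, MulAction.mem_stabilizer_iff] at hs ht
    rw [mul_smul, ht, mul_smul, ← matrixAut_apply s x (b • x), hs]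
  · intro hg
    obtain ⟨s, hs1, hs2⟩ := ht _ _ _ _ hg.symm
    refine ⟨s, hs1, (s * b)⁻¹ * g, ?_, by group⟩
    rw [SetLike.mem_coe, MulAction.mem_stabilizer_iff, mul_smul, inv_smul_eq_iff, mul_smul]
    exact hs2.symm

/-- An automorphism group with prescribed level sets gives a Higman pair. -/
lemma isHigmanKey (h : IsRootGram μ M) (ht : IsLevelTransitive M) (hn : 3 ≤ n)
    {x : Fin n × rootsOfUnity r ℂ} {b : matrixAut M} (hb : M x (b • x) = μ) :
    IsHigmanKey (MulAction.stabilizer (matrixAut M) x) b := by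
  have hN := h.mem_normalizer_stabilizer ht hn x
  have hD := mem_doubleCoset_stabilizer_iff ht x b
  refine ⟨?_, ?_, ?_, ?_, ?_, ?_⟩
  · rw [hN]
    exact (h.line_ne_of_apply hb).symm
  · rw [MulAction.is_two_pretransitive_iff]
    intro a b c d hab hcd
    induction a using QuotientGroup.induction_on with | H g₁ => ?_
    induction b using QuotientGroup.induction_on with | H g₂ => ?_
    induction c using QuotientGroup.induction_on with | H g₃ => ?_
    induction d using QuotientGroup.induction_on with | H g₄ => ?_
    -- Cosets of the normalizer are the lines.
    have hne : ∀ g g' : matrixAut M, ((g : matrixAut M ⧸ Subgroup.normalizer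
        (MulAction.stabilizer (matrixAut M) x : Set (matrixAut M))) = g') ↔
        (g • x).1 = (g' • x).1 := by
      intro g g'
      rw [QuotientGroup.eq, hN, ← h.line_smul_iff g, mul_smul, smul_inv_smul, eq_comm]
    obtain ⟨z, hz⟩ := h.exists_rot_apply (mt (hne g₁ g₂).2 hab)
    obtain ⟨w, hw⟩ := h.exists_rot_apply (mt (hne g₃ g₄).2 hcd)
    obtain ⟨g, hg1, hg2⟩ := ht _ _ _ _ (hz.trans hw.symm)
    refine ⟨g, (hne (g * g₁) g₃).2 ?_, (hne (g * g₂) g₄).2 ?_⟩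
    · rw [mul_smul, hg1]
    · rw [h.smul_rot] at hg2
      rw [mul_smul]
      have := congrArg Prod.fst hg2
      exact this
  · intro u v
    induction u using QuotientGroup.induction_on with | H u => ?_
    induction v using QuotientGroup.induction_on with | H v => ?_
    rw [← QuotientGroup.mk_mul, ← QuotientGroup.mk_mul, QuotientGroup.eq,
      Subgroup.mem_subgroupOf, MulAction.mem_stabilizer_iff]
    obtain ⟨z, hz⟩ := exists_eq_rot ((hN u).1 u.2).symm
    obtain ⟨w, hw⟩ := exists_eq_rot ((hN v).1 v.2).symm
    simp only [Subgroup.coe_mul, Subgroup.coe_inv, mul_smul]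
    rw [inv_smul_eq_iff, mul_smul, hz, hw, h.smul_rot, h.smul_rot, hz, hw, ← rot_mul, ← rot_mul,
      mul_comm]
  · have hb' : M x (b⁻¹ • x) = μ := by
      rw [← matrixAut_apply b, smul_inv_smul]
      exact h.swap_apply hb
    ext g
    rw [hD, mem_doubleCoset_stabilizer_iff ht, hb, hb']
  · intro a ha
    obtain ⟨z, hz⟩ := exists_eq_rot ((hN _).1 (inv_mem ha)).symm
    rw [hD, ← matrixAut_apply a⁻¹, mul_assoc, mul_smul a, inv_smul_smul, mul_smul, hz, h.smul_rot,
      h.rot_apply_rot]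
  · intro a ha hab
    -- The element `a` acts on `x` by a phase, which multiplies the entry `μ`; equality with `μ ≠ 0`
    -- forces the phase to be 1.
    obtain ⟨z, hz⟩ := exists_eq_rot ((hN _).1 (inv_mem ha)).symm
    rw [hD, ← matrixAut_apply a⁻¹, mul_smul, inv_smul_smul, hz, h.rot_apply_left, hb] at hab
    have hz1 : star ((z : ℂˣ) : ℂ) = 1 := by
      have : (μ : ℂ) ≠ 0 := by exact_mod_cast h.pos.ne'
      simpa [this] using hab
    have hz2 : z = 1 := by
      apply root_injective
      have := star_mul_root z
      rw [hz1, one_mul] at this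
      simpa using this
    rw [MulAction.mem_stabilizer_iff, eq_comm, ← inv_smul_eq_iff, hz, hz2]
    simp

end IsRootGram

end RootGram
end LineSystem

/-! ### Commutativity of the adjacency algebra -/

namespace LineSystem
namespace IsRootGram

variable {n r : ℕ} [NeZero r] {μ : ℝ}
  {M : Matrix (Fin n × rootsOfUnity r ℂ) (Fin n × rootsOfUnity r ℂ) ℂ}

/-- The zero-one matrix of the pairs at which the matrix has a given entry. -/
noncomputable def levelMatrix {X : Type*} (M : Matrix X X ℂ) (t : ℂ) : Matrix X X ℂ :=
  open Classical in Matrix.of fun x y => if M x y = t then 1 else 0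

lemma levelMatrix_smul {X : Type*} {M : Matrix X X ℂ} (t : ℂ) (g : matrixAut M) (x y : X) :
    levelMatrix M t (g • x) (g • y) = levelMatrix M t x y := by
  simp only [levelMatrix, Matrix.of_apply, matrixAut_apply g]

lemma orbitMatrix_eq_levelMatrix {X : Type*} {M : Matrix X X ℂ} (ht : IsLevelTransitive M)
    (q : MulAction.orbitRel.Quotient (matrixAut M) (X × X)) :
    ∃ x y, orbitMatrix (matrixAut M) X q = levelMatrix M (M x y) := by
  induction q using Quotient.inductionOn with | h p => ?_
  refine ⟨p.1, p.2, ?_⟩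
  ext u v
  simp only [orbitMatrix, levelMatrix, Matrix.of_apply]
  congr 1
  rw [eq_iff_iff]
  refine (mk_eq_mk_iff (matrixAut M) X u v p.1 p.2).trans ⟨?_, fun h => ht _ _ _ _ h.symm⟩
  rintro ⟨g, rfl, rfl⟩
  rw [matrixAut_apply g]

lemma levelMatrix_root (h : IsRootGram μ M) (z : rootsOfUnity r ℂ) (x y) :
    levelMatrix M ((z : ℂˣ) : ℂ) x y = if y = rot z x then 1 else 0 := by
  classical
  simp only [levelMatrix, Matrix.of_apply]
  congr 1
  rw [eq_iff_iff]
  refine ⟨h.eq_rot_of_apply, ?_⟩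
  rintro rfl
  rw [h.apply_rot_self]

omit [NeZero r] in
lemma levelMatrix_mul_root (h : IsRootGram μ M) (z : rootsOfUnity r ℂ) (x y) :
    levelMatrix M (μ * ((z : ℂˣ) : ℂ)) x y = levelMatrix M μ x (rot z⁻¹ y) := by
  classical
  simp only [levelMatrix, Matrix.of_apply]
  congr 1
  rw [eq_iff_iff, h.apply_rot, InvMemClass.coe_inv, Units.inv_mul_eq_iff_eq_mul,
    mul_comm (μ : ℂ)]

variable [Fintype (rootsOfUnity r ℂ)]

/-- This level matrix is the permutation matrix of a rotation, and rotations are themselves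
automorphisms. -/
lemma levelMatrix_root_mul (h : IsRootGram μ M) (z : rootsOfUnity r ℂ)
    {N : Matrix (Fin n × rootsOfUnity r ℂ) (Fin n × rootsOfUnity r ℂ) ℂ}
    (hN : ∀ (g : matrixAut M) x y, N (g • x) (g • y) = N x y) :
    levelMatrix M ((z : ℂˣ) : ℂ) * N = N * levelMatrix M ((z : ℂˣ) : ℂ) := by
  ext x y
  simp only [Matrix.mul_apply, h.levelMatrix_root]
  have h1 : ∀ u, y = rot z u ↔ u = (rot z).symm y := fun u => by
    rw [Equiv.eq_symm_apply, eq_comm]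
  simp only [h1, ite_mul, one_mul, zero_mul, mul_ite, mul_one, mul_zero, Finset.sum_ite_eq',
    Finset.mem_univ, if_true]
  rw [← hN (h.rotAut z) x, rotAut_smul, rotAut_smul, Equiv.apply_symm_apply]

/-- Rotating the summation variable collects both phases in the last argument. The result is
symmetric in `z` and `w`, so these matrices commute. -/
lemma levelMatrix_mul_levelMatrix (h : IsRootGram μ M) (z w : rootsOfUnity r ℂ) (x y) :
    (levelMatrix M (μ * ((z : ℂˣ) : ℂ)) * levelMatrix M (μ * ((w : ℂˣ) : ℂ))) x y =
      ∑ u, levelMatrix M μ x u * levelMatrix M μ u (rot (z⁻¹ * w⁻¹) y) := by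
  simp only [Matrix.mul_apply, h.levelMatrix_mul_root]
  rw [← Equiv.sum_comp (rot z⁻¹)
    fun u => levelMatrix M μ x u * levelMatrix M μ u (rot (z⁻¹ * w⁻¹) y)]
  refine Finset.sum_congr rfl fun u _ => ?_
  rw [rot_mul, ← rotAut_smul h z⁻¹ (rot w⁻¹ y), ← rotAut_smul h z⁻¹ u, levelMatrix_smul]

/-- The adjacency algebra is commutative. -/
lemma mul_comm_of_stable (h : IsRootGram μ M) (ht : IsLevelTransitive M)
    {N N' : Matrix (Fin n × rootsOfUnity r ℂ) (Fin n × rootsOfUnity r ℂ) ℂ}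
    (hN : ∀ (g : matrixAut M) x y, N (g • x) (g • y) = N x y)
    (hN' : ∀ (g : matrixAut M) x y, N' (g • x) (g • y) = N' x y) : N * N' = N' * N := by
  have h1 := (mem_span_orbitMatrix_iff _ _ N).2 hN
  have h2 := (mem_span_orbitMatrix_iff _ _ N').2 hN'
  clear hN hN'
  induction h1, h2 using Submodule.span_induction₂ with
  | mem_mem A B hA hB =>
    have hBs := (mem_span_orbitMatrix_iff _ _ B).1 (Submodule.subset_span hB)
    have hAs := (mem_span_orbitMatrix_iff _ _ A).1 (Submodule.subset_span hA)
    obtain ⟨p, rfl⟩ := hA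
    obtain ⟨q, rfl⟩ := hB
    obtain ⟨x, y, hp⟩ := orbitMatrix_eq_levelMatrix ht p
    obtain ⟨x', y', hq⟩ := orbitMatrix_eq_levelMatrix ht q
    by_cases hxy : x.1 = y.1
    · obtain ⟨z, rfl⟩ := exists_eq_rot hxy
      rw [h.apply_rot_self] at hp
      rw [hp, h.levelMatrix_root_mul z hBs]
    by_cases hxy' : x'.1 = y'.1
    · obtain ⟨z, rfl⟩ := exists_eq_rot hxy'
      rw [h.apply_rot_self] at hq
      rw [hq, h.levelMatrix_root_mul z hAs]
    obtain ⟨z, hz⟩ := h.exists_phase x y hxy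
    obtain ⟨w, hw⟩ := h.exists_phase x' y' hxy'
    rw [hp, hq, hz, hw]
    ext u v
    rw [h.levelMatrix_mul_levelMatrix, h.levelMatrix_mul_levelMatrix, mul_comm z⁻¹]
  | zero_left => simp
  | zero_right => simp
  | add_left A B C _ _ _ h1 h2 => rw [add_mul, mul_add, h1, h2]
  | add_right A B C _ _ _ h1 h2 => rw [add_mul, mul_add, h1, h2]
  | smul_left c A B _ _ h1 => rw [smul_mul_assoc, mul_smul_comm, h1]
  | smul_right c A B _ _ h1 => rw [smul_mul_assoc, mul_smul_comm, h1]

/-! ### The quadratic relation and the primitive idempotent -/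

/-- The block diagonal part of the matrix. -/
def linePart (M : Matrix (Fin n × rootsOfUnity r ℂ) (Fin n × rootsOfUnity r ℂ) ℂ) :
    Matrix (Fin n × rootsOfUnity r ℂ) (Fin n × rootsOfUnity r ℂ) ℂ :=
  Matrix.of fun x y => if x.1 = y.1 then M x y else 0

/-- The phases of `M` and `v` cancel, so each of the `r` points on the line of `x` contributes `v
x`. -/
lemma sum_linePart_mul (h : IsRootGram μ M) {v : Fin n × rootsOfUnity r ℂ → ℂ}
    (hv : ∀ x z, v (rot z x) = star ((z : ℂˣ) : ℂ) * v x) (x) :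
    ∑ y, linePart M x y * v y = r * v x := by
  have key : ∀ y : Fin n × rootsOfUnity r ℂ,
      linePart M x y * v y = if x.1 = y.1 then v x else 0 := by
    intro y
    simp only [linePart, Matrix.of_apply]
    split_ifs with hxy
    · obtain ⟨z, rfl⟩ := exists_eq_rot hxy
      rw [h.apply_rot_self, hv, ← mul_assoc, mul_comm _ (star _), star_mul_root, one_mul]
    · rw [zero_mul]
  have hcard : Fintype.card (rootsOfUnity r ℂ) = r := by
    rw [← Nat.card_eq_fintype_card, Complex.card_rootsOfUnity]
  simp only [key, Fintype.sum_prod_type]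
  rw [Finset.sum_comm]
  simp [hcard]

-- Up to phases there are only two kinds of pairs, collinear and not, each forming one orbit. Hence
-- `N` is determined by two of its entries.
omit [NeZero r] [Fintype (rootsOfUnity r ℂ)] in
lemma eq_linePart_add (h : IsRootGram μ M) (ht : IsLevelTransitive M) (hn : 3 ≤ n)
    {N : Matrix (Fin n × rootsOfUnity r ℂ) (Fin n × rootsOfUnity r ℂ) ℂ}
    (hN : ∀ (g : matrixAut M) x y, N (g • x) (g • y) = N x y)
    (hr : ∀ x y z, N x (rot z y) = ((z : ℂˣ) : ℂ) * N x y) :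
    ∃ a b : ℂ, N = a • linePart M + b • M := by
  have hμ : (μ : ℂ) ≠ 0 := by exact_mod_cast h.pos.ne'
  let x₀ : Fin n × rootsOfUnity r ℂ := (⟨0, by omega⟩, 1)
  obtain ⟨z₁, h₀⟩ := h.exists_rot_apply (x := x₀) (y := (⟨1, by omega⟩, 1)) (by simp [x₀])
  generalize rot z₁ ((⟨1, by omega⟩, 1) : Fin n × rootsOfUnity r ℂ) = y₀ at h₀
  -- Solves `a + b = N x₀ x₀` and `b * μ = N x₀ y₀`.
  refine ⟨N x₀ x₀ - N x₀ y₀ / μ, N x₀ y₀ / μ, ?_⟩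
  ext x y
  simp only [linePart, Matrix.add_apply, Matrix.smul_apply, Matrix.of_apply, smul_eq_mul]
  split_ifs with hxy
  · obtain ⟨z, rfl⟩ := exists_eq_rot hxy
    have := h.isPretransitive ht
    obtain ⟨g, rfl⟩ := MulAction.exists_smul_eq (matrixAut M) x₀ x
    rw [hr, hN, h.apply_rot_self]
    ring
  · obtain ⟨z, hz⟩ := h.exists_rot_apply hxy
    obtain ⟨g, hg1, hg2⟩ := ht _ _ _ _ (h₀.trans hz.symm)
    have h1 := hN g x₀ y₀
    rw [hg1, hg2, hr] at h1
    rw [h.apply_rot] at hz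
    rw [← h1]
    field_simp
    linear_combination (-N x y) * hz

/-- A singular matrix satisfies a quadratic equation without constant term. -/
lemma exists_mul_self (h : IsRootGram μ M) (ht : IsLevelTransitive M) (hn : 3 ≤ n)
    {v : Fin n × rootsOfUnity r ℂ → ℂ} (hv : ∀ x z, v (rot z x) = star ((z : ℂˣ) : ℂ) * v x)
    (hv0 : v ≠ 0) (hMv : M *ᵥ v = 0) : ∃ b : ℝ, b ≠ 0 ∧ M * M = (b : ℂ) • M := by
  obtain ⟨a, b, hab⟩ := h.eq_linePart_add ht hn (N := M * M) (by
      intro g x y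
      rw [Matrix.mul_apply, Matrix.mul_apply, ← Equiv.sum_comp (MulAction.toPerm g)]
      simp only [MulAction.toPerm_apply, matrixAut_apply g]) (by
      intro x y z
      simp only [Matrix.mul_apply, h.apply_rot, Finset.mul_sum, mul_left_comm])
  -- Applied to the kernel vector, the relation reads `0 = a * r * v`.
  have ha : a = 0 := by
    obtain ⟨x, hx⟩ := Function.ne_iff.1 hv0
    have h1 := congrArg (fun N => (N *ᵥ v) x) hab
    simp only [← Matrix.mulVec_mulVec, Matrix.add_mulVec, Matrix.smul_mulVec, hMv,
      Matrix.mulVec_zero, smul_zero, add_zero, Pi.smul_apply, Pi.zero_apply] at h1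
    have h2 : (linePart M *ᵥ v) x = r * v x := h.sum_linePart_mul hv x
    rw [h2, smul_eq_mul, eq_comm, mul_eq_zero, mul_eq_zero] at h1
    exact h1.resolve_right (not_or.2 ⟨by exact_mod_cast NeZero.ne r, hx⟩)
  rw [ha, zero_smul, zero_add] at hab
  let x₀ : Fin n × rootsOfUnity r ℂ := (⟨0, by omega⟩, 1)
  -- The diagonal entry of `M * M` is a squared row norm, hence real and positive.
  have hb : b = ((∑ y, ‖M x₀ y‖ ^ 2 : ℝ) : ℂ) := by
    have h1 := congrFun (congrFun hab x₀) x₀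
    rw [Matrix.smul_apply, h.apply_self, smul_eq_mul, mul_one, Matrix.mul_apply] at h1
    rw [← h1, Complex.ofReal_sum]
    refine Finset.sum_congr rfl fun y _ => ?_
    rw [← h.conj_apply x₀, Complex.star_def, Complex.mul_conj']
    simp
  refine ⟨_, ?_, hb ▸ hab⟩
  refine (Finset.sum_pos' (fun y _ => by positivity) ⟨x₀, Finset.mem_univ _, ?_⟩).ne'
  rw [h.apply_self]
  simp

omit [NeZero r] in
lemma isStarProjection_smul (h : IsRootGram μ M) {b : ℝ} (hb : b ≠ 0)
    (hM : M * M = (b : ℂ) • M) : IsStarProjection ((b : ℂ)⁻¹ • M) := by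
  have hb' : (b : ℂ) ≠ 0 := by exact_mod_cast hb
  constructor
  · rw [IsIdempotentElem, smul_mul_smul_comm, hM, smul_smul]
    congr 1
    field_simp
  · rw [IsSelfAdjoint, star_smul]
    congr 1
    · simp
    · ext x y
      rw [Matrix.star_apply, h.conj_apply]

/-- By commutativity `Q` is also `b⁻¹ • (Q * M)`, so it inherits phase equivariance from `M` and
lies in the span of `linePart M` and `M`. Multiplying by `M` sends this span to multiples of `M`,
and idempotency leaves two possible multiples. -/
lemma eq_zero_or_eq_smul (h : IsRootGram μ M) (ht : IsLevelTransitive M) (hn : 3 ≤ n)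
    {b : ℝ} (hb : b ≠ 0) (hM : M * M = (b : ℂ) • M)
    {Q : Matrix (Fin n × rootsOfUnity r ℂ) (Fin n × rootsOfUnity r ℂ) ℂ}
    (hQ : ∀ (g : matrixAut M) x y, Q (g • x) (g • y) = Q x y) (hQ2 : Q * Q = Q)
    (hMQ : ((b : ℂ)⁻¹ • M) * Q = Q) : Q = 0 ∨ Q = (b : ℂ)⁻¹ • M := by
  have hb' : (b : ℂ) ≠ 0 := by exact_mod_cast hb
  have hQM : Q = (b : ℂ)⁻¹ • (Q * M) := by
    rw [h.mul_comm_of_stable ht hQ (fun g x y => matrixAut_apply g x y), ← smul_mul_assoc, hMQ]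
  obtain ⟨a, c, hac⟩ := h.eq_linePart_add ht hn hQ (by
    intro x y z
    rw [hQM]
    simp only [Matrix.smul_apply, smul_eq_mul, Matrix.mul_apply, h.apply_rot, Finset.mul_sum,
      mul_left_comm])
  have hE : linePart M * M = (r : ℂ) • M := by
    ext x y
    rw [Matrix.mul_apply, h.sum_linePart_mul (v := fun u => M u y)
      (fun u z => h.rot_apply_left u y z)]
    rfl
  obtain ⟨t, htM⟩ : ∃ t : ℂ, Q = t • M := by
    refine ⟨(b : ℂ)⁻¹ * (a * r + c * b), ?_⟩
    rw [hQM, hac, add_mul, smul_mul_assoc, smul_mul_assoc, hE, hM, smul_smul, smul_smul,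
      ← add_smul, smul_smul]
  have h0 := congrFun (congrFun hQ2 (⟨0, by omega⟩, 1)) (⟨0, by omega⟩, 1)
  rw [htM, smul_mul_smul_comm, hM] at h0
  simp only [Matrix.smul_apply, h.apply_self, smul_eq_mul, mul_one] at h0
  by_cases h1 : t = 0
  · left
    rw [htM, h1, zero_smul]
  · right
    rw [htM]
    congr 1
    field_simp
    field_simp at h0
    linear_combination h0

/-- The Higman pair and the primitive idempotent of a singular matrix. -/
theorem exists_isHigmanPair (h : IsRootGram μ M) (ht : IsLevelTransitive M) (hn : 3 ≤ n)
    {v : Fin n × rootsOfUnity r ℂ → ℂ} (hv : ∀ x z, v (rot z x) = star ((z : ℂˣ) : ℂ) * v x)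
    (hv0 : v ≠ 0) (hMv : M *ᵥ v = 0) :
    ∃ (G : Type) (_ : Group G) (H : Subgroup G) (_ : Fintype (G ⧸ H))
        (e : G ⧸ H ≃ Fin n × rootsOfUnity r ℂ),
        IsHigmanPair G H ∧
        (schurianScheme G (G ⧸ H)).IsCarriedBy (M.submatrix e e) ∧
        (schurianScheme G (G ⧸ H)).IsCommutative ∧
        ∃ c : ℂ, (schurianScheme G (G ⧸ H)).IsPrimitiveIdempotent (c • M.submatrix e e) := by
  have := h.isPretransitive ht
  let x₀ : Fin n × rootsOfUnity r ℂ := (⟨0, by omega⟩, 1)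
  let H := MulAction.stabilizer (matrixAut M) x₀
  obtain ⟨z₁, h₀⟩ := h.exists_rot_apply (x := x₀) (y := (⟨1, by omega⟩, 1)) (by simp [x₀])
  obtain ⟨k, hk⟩ := MulAction.exists_smul_eq (matrixAut M) x₀
    (rot z₁ ((⟨1, by omega⟩, 1) : Fin n × rootsOfUnity r ℂ))
  rw [← hk] at h₀
  have hkey := h.isHigmanKey ht hn h₀
  let e : matrixAut M ⧸ H ≃ Fin n × rootsOfUnity r ℂ :=
    Equiv.ofBijective (MulAction.ofQuotientStabilizer (matrixAut M) x₀)
      ⟨MulAction.injective_ofQuotientStabilizer _ _, fun y => by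
        obtain ⟨g, hg⟩ := MulAction.exists_smul_eq (matrixAut M) x₀ y
        exact ⟨(g : matrixAut M ⧸ H), hg⟩⟩
  have he : ∀ (g : matrixAut M) q, e (g • q) = g • e q := fun g q =>
    MulAction.ofQuotientStabilizer_smul (matrixAut M) x₀ g q
  have he' : ∀ (g : matrixAut M) x, e.symm (g • x) = g • e.symm x := fun g x => by
    rw [Equiv.symm_apply_eq, he, Equiv.apply_symm_apply]
  let _ : Fintype (matrixAut M ⧸ H) := Fintype.ofEquiv _ e.symm
  have hstab : ∀ N ∈ (schurianScheme (matrixAut M) (matrixAut M ⧸ H)).adjacencyAlgebra,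
      ∀ (g : matrixAut M) x y, N.submatrix e.symm e.symm (g • x) (g • y) =
        N.submatrix e.symm e.symm x y := by
    intro N hN g x y
    simp only [Matrix.submatrix_apply, he']
    exact (mem_span_orbitMatrix_iff _ _ N).1 hN g _ _
  have hsub : ∀ N : Matrix (matrixAut M ⧸ H) (matrixAut M ⧸ H) ℂ,
      N = (N.submatrix e.symm e.symm).submatrix e e := fun N => by simp
  have hmul : ∀ A B : Matrix (Fin n × rootsOfUnity r ℂ) (Fin n × rootsOfUnity r ℂ) ℂ,
      A.submatrix e e * B.submatrix e e = (A * B).submatrix e e := fun A B =>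
    Matrix.submatrix_mul_equiv A B e e e
  obtain ⟨b, hb, hM⟩ := h.exists_mul_self ht hn hv hv0 hMv
  have hP := h.isStarProjection_smul hb hM
  refine ⟨matrixAut M, inferInstance, H, inferInstance, e, ⟨inferInstance, ?_, k, hkey⟩, ?_, ?_,
    (b : ℂ)⁻¹, ?_, ?_, ?_, ?_⟩
  · intro htop
    refine h.line_ne_of_apply h₀ ?_
    have : k ∈ H := htop ▸ Subgroup.mem_top k
    rw [MulAction.mem_stabilizer_iff.1 this]
  · refine isCarriedBy_schurianScheme (fun g x y => ?_) fun x y x' y' hxy => ?_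
    · rw [Matrix.submatrix_apply, he, he, matrixAut_apply g, Matrix.submatrix_apply]
    · obtain ⟨g, h1, h2⟩ := ht _ _ _ _ hxy.symm
      exact ⟨g, e.injective (by rw [he, h1]), e.injective (by rw [he, h2])⟩
  · intro N hN N' hN'
    rw [hsub N, hsub N', hmul, hmul, h.mul_comm_of_stable ht (hstab N hN) (hstab N' hN')]
  · refine Submodule.smul_mem _ _ ((mem_span_orbitMatrix_iff _ _ _).2 fun g x y => ?_)
    rw [Matrix.submatrix_apply, he, he, matrixAut_apply g, Matrix.submatrix_apply]
  · constructor
    · have := hP.isIdempotentElem.eq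
      change ((b : ℂ)⁻¹ • M).submatrix e e * ((b : ℂ)⁻¹ • M).submatrix e e =
        ((b : ℂ)⁻¹ • M).submatrix e e
      rw [hmul, this]
    · have := hP.isSelfAdjoint.star_eq
      change (((b : ℂ)⁻¹ • M).submatrix e e)ᴴ = ((b : ℂ)⁻¹ • M).submatrix e e
      rw [Matrix.conjTranspose_submatrix, ← Matrix.star_eq_conjTranspose, this]
  · intro h0
    have := congrFun (congrFun h0 (e.symm x₀)) (e.symm x₀)
    simp [h.apply_self] at this
    exact hb this
  · intro Q hQ hQ2 hPQ
    have h1 : Q.submatrix e.symm e.symm * Q.submatrix e.symm e.symm = Q.submatrix e.symm e.symm := by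
      rw [Matrix.submatrix_mul_equiv, hQ2.isIdempotentElem.eq]
    have h2 : ((b : ℂ)⁻¹ • M) * Q.submatrix e.symm e.symm = Q.submatrix e.symm e.symm := by
      conv_rhs => rw [← hPQ]
      rw [← Matrix.submatrix_mul_equiv _ _ _ e.symm]
      congr 1
      ext x y
      simp
    rw [hsub Q]
    rcases h.eq_zero_or_eq_smul ht hn hb hM (hstab Q hQ) h1 h2 with h3 | h3
    · left; rw [h3]; rfl
    · right; rw [h3]; rfl

end IsRootGram
end LineSystem

/-! ### From lines to Gram matrices, and from automorphisms back to unitaries -/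

namespace LineSystem

/-- Systems of vectors with equal Gram matrices are unitarily equivalent. -/
lemma exists_linearIsometryEquiv {ι E : Type*} [Fintype ι] [NormedAddCommGroup E]
    [InnerProductSpace ℂ E] [FiniteDimensional ℂ E] {ψ χ : ι → E}
    (h : Matrix.gram ℂ ψ = Matrix.gram ℂ χ) : ∃ U : E ≃ₗᵢ[ℂ] E, ∀ i, U (ψ i) = χ i := by
  classical
  let f := Fintype.linearCombination ℂ ψ
  let g := Fintype.linearCombination ℂ χ
  have hnorm : ∀ x, ‖f x‖ = ‖g x‖ := by
    intro x
    have h1 := Matrix.star_dotProduct_gram_mulVec ψ x x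
    rw [h, Matrix.star_dotProduct_gram_mulVec χ x x] at h1
    change inner ℂ (g x) (g x) = inner ℂ (f x) (f x) at h1
    rw [@norm_eq_sqrt_re_inner ℂ, @norm_eq_sqrt_re_inner ℂ, h1]
  have hker : LinearMap.ker f ≤ LinearMap.ker g := by
    intro x hx
    rw [LinearMap.mem_ker] at hx ⊢
    rw [← norm_eq_zero, ← hnorm, hx, norm_zero]
  let A : LinearMap.range f →ₗ[ℂ] E :=
    (LinearMap.ker f).liftQ g hker ∘ₗ f.quotKerEquivRange.symm.toLinearMap
  -- The Gram matrix determines the norms of linear combinations, so sending a combination of the `ψ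
  -- i` to the same combination of the `χ i` is well defined and isometric on the span.
  have hA : ∀ x, A ⟨f x, LinearMap.mem_range_self f x⟩ = g x := by
    intro x
    have : f.quotKerEquivRange.symm ⟨f x, LinearMap.mem_range_self f x⟩ =
        (LinearMap.ker f).mkQ x := f.quotKerEquivRange_symm_apply_image x _
    simp only [A, LinearMap.comp_apply, LinearEquiv.coe_coe, this]
    simp
  let B : LinearMap.range f →ₗᵢ[ℂ] E := ⟨A, by
    rintro ⟨_, x, rfl⟩
    rw [hA, ← hnorm]
    rfl⟩
  refine ⟨B.extend.toLinearIsometryEquiv rfl, fun i => ?_⟩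
  have h1 := hA (Pi.single i 1)
  have hf : f (Pi.single i 1) = ψ i := by simp [f]
  have hg : g (Pi.single i 1) = χ i := by simp [g]
  rw [LinearIsometry.toLinearIsometryEquiv_apply]
  have h2 := B.extend_apply ⟨f (Pi.single i 1), LinearMap.mem_range_self f _⟩
  simp only [hf] at h2
  rw [h2, ← hg, ← h1]
  simp only [hf]
  rfl

section Lines

variable {d n : ℕ} {L : Fin n → Submodule ℂ (EuclideanSpace ℂ (Fin d))}
  {φ : Fin n → EuclideanSpace ℂ (Fin d)}

lemma IsUnitRepresentatives.ne_zero (hφ : IsUnitRepresentatives L φ) (i) : φ i ≠ 0 := by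
  rw [← norm_ne_zero_iff, (hφ i).2]
  exact one_ne_zero

lemma IsUnitRepresentatives.eq_span (hline : ∀ i, Module.finrank ℂ (L i) = 1)
    (hφ : IsUnitRepresentatives L φ) (i) : L i = Submodule.span ℂ {φ i} := by
  have := Module.finite_of_finrank_eq_succ (hline i)
  refine (Submodule.eq_of_le_of_finrank_eq ?_ ?_).symm
  · rw [Submodule.span_singleton_le_iff_mem]
    exact (hφ i).1
  · rw [finrank_span_singleton (hφ.ne_zero i), hline]

lemma exists_isUnitRepresentatives (hline : ∀ i, Module.finrank ℂ (L i) = 1) :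
    ∃ φ, IsUnitRepresentatives L φ := by
  have : ∀ i, ∃ v, v ∈ L i ∧ ‖v‖ = 1 := by
    intro i
    have : Nontrivial (L i) := Module.nontrivial_of_finrank_pos (R := ℂ) (by rw [hline]; simp)
    obtain ⟨⟨v, hv⟩, hv0⟩ := exists_ne (0 : L i)
    have hv1 : ‖v‖ ≠ 0 := by simpa using hv0
    refine ⟨((‖v‖ : ℂ)⁻¹) • v, Submodule.smul_mem _ _ hv, ?_⟩
    rw [norm_smul, norm_inv, Complex.norm_real, norm_norm, inv_mul_cancel₀ hv1]
  choose φ hφ using this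
  exact ⟨φ, hφ⟩

/-- With at most two indices the dependent line would lie in the only other line, hence equal it. -/
lemma three_le (hline : ∀ i, Module.finrank ℂ (L i) = 1) (hdep : IsLinearlyDependent L)
    (hne : ∃ i j, L i ≠ L j) : 3 ≤ n := by
  by_contra hn
  obtain ⟨k, hk⟩ := hdep
  obtain ⟨i, j, hij⟩ := hne
  have key : ∀ l, L l = L k := by
    intro l
    by_cases hl : l = k
    · rw [hl]
    have hle : L k ≤ L l := hk.trans (iSup_le fun j => by
      have : (j : Fin n) = l := by
        obtain ⟨j, hj⟩ := j
        simp only [Fin.ext_iff] at hj hl ⊢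
        omega
      rw [this])
    have := Module.finite_of_finrank_eq_succ (hline l)
    exact (Submodule.eq_of_le_of_finrank_eq hle (by rw [hline, hline])).symm
  exact hij (by rw [key i, key j])

/-- A nontrivial linear relation between representatives of linearly dependent lines. -/
lemma IsLinearlyDependent.exists_relation (hline : ∀ i, Module.finrank ℂ (L i) = 1)
    (hdep : IsLinearlyDependent L) (hφ : IsUnitRepresentatives L φ) :
    ∃ w : Fin n → ℂ, w ≠ 0 ∧ ∑ i, w i • φ i = 0 := by
  have : ¬ LinearIndependent ℂ φ := by
    rw [linearIndependent_iff_notMem_span]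
    push Not
    obtain ⟨i, hi⟩ := hdep
    refine ⟨i, ?_⟩
    have h1 : ⨆ j : {j : Fin n // j ≠ i}, L j ≤ Submodule.span ℂ (φ '' (Set.univ \ {i})) := by
      refine iSup_le fun j => ?_
      rw [hφ.eq_span hline j, Submodule.span_singleton_le_iff_mem]
      exact Submodule.subset_span ⟨j, ⟨Set.mem_univ _, j.2⟩, rfl⟩
    exact h1 (hi (hφ i).1)
  obtain ⟨w, hw, i, hi⟩ := Fintype.not_linearIndependent_iff.1 this
  exact ⟨w, fun h => hi (by rw [h]; rfl), hw⟩

/-- Orthogonal unit vectors are independent; this excludes `μ = 0`. -/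
lemma IsLinearlyDependent.exists_inner_ne_zero (hline : ∀ i, Module.finrank ℂ (L i) = 1)
    (hdep : IsLinearlyDependent L) (hφ : IsUnitRepresentatives L φ) :
    ∃ i j, i ≠ j ∧ inner ℂ (φ i) (φ j) ≠ 0 := by
  obtain ⟨w, hw, hsum⟩ := hdep.exists_relation hline hφ
  obtain ⟨i, hi⟩ := Function.ne_iff.1 hw
  by_contra! hall
  have h1 := congrArg (inner ℂ (φ i)) hsum
  rw [inner_sum, Finset.sum_eq_single i, inner_smul_right, inner_self_eq_norm_sq_to_K, (hφ i).2,
    inner_zero_right] at h1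
  · exact hi (by simpa using h1)
  · intro j _ hj
    rw [inner_smul_right, hall i j hj.symm, mul_zero]
  · simp

lemma IsUnitRepresentatives.eq_of_norm_inner (hline : ∀ i, Module.finrank ℂ (L i) = 1)
    (hφ : IsUnitRepresentatives L φ) {i j} (h : ‖inner ℂ (φ i) (φ j)‖ = 1) : L i = L j := by
  have h1 : ‖inner ℂ (φ i) (φ j)‖ = ‖φ i‖ * ‖φ j‖ := by rw [h, (hφ i).2, (hφ j).2, mul_one]
  obtain ⟨c, hc, h2⟩ := (norm_inner_eq_norm_iff (hφ.ne_zero i) (hφ.ne_zero j)).1 h1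
  rw [hφ.eq_span hline i, hφ.eq_span hline j, h2,
    Submodule.span_singleton_smul_eq (IsUnit.mk0 c hc)]

lemma IsUnitRepresentatives.norm_inner_le (hφ : IsUnitRepresentatives L φ) (i j) :
    ‖inner ℂ (φ i) (φ j)‖ ≤ 1 :=
  (norm_inner_le_norm _ _).trans (by rw [(hφ i).2, (hφ j).2, mul_one])

lemma multiplesGram_apply {r : ℕ} (x y : Fin n × rootsOfUnity r ℂ) :
    multiplesGram φ r x y =
      star ((x.2 : ℂˣ) : ℂ) * (((y.2 : ℂˣ) : ℂ) * inner ℂ (φ x.1) (φ y.1)) := by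
  simp only [multiplesGram, Matrix.gram_apply, inner_smul_left, inner_smul_right]
  rw [Complex.star_def, mul_left_comm]

lemma isRootGram_multiplesGram {r : ℕ} [NeZero r] (hline : ∀ i, Module.finrank ℂ (L i) = 1)
    (hne : ∃ i j, L i ≠ L j) (hφ : IsUnitRepresentatives L φ)
    (hr : HasRootsOfUnitySignature φ r) : ∃ μ, IsRootGram μ (multiplesGram φ r) := by
  obtain ⟨S, ⟨μ, hμ, hμ', rfl⟩, hS⟩ := hr
  obtain ⟨i₀, j₀, hij⟩ := hne
  have hij' : i₀ ≠ j₀ := fun h => hij (h ▸ rfl)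
  have h1 : ∀ x : Fin n × rootsOfUnity r ℂ, multiplesGram φ r x x = 1 := by
    intro x
    rw [multiplesGram_apply, ← mul_assoc, IsRootGram.star_mul_root, one_mul,
      inner_self_eq_norm_sq_to_K, (hφ _).2]
    simp
  refine ⟨μ, ?_, ?_, ?_, ?_, h1, ?_⟩
  · exact lt_of_le_of_ne (hμ' i₀ j₀ hij' ▸ norm_nonneg _) hμ.symm
  -- The equality case of Cauchy–Schwarz would identify two distinct lines.
  · refine lt_of_le_of_ne (hμ' i₀ j₀ hij' ▸ hφ.norm_inner_le i₀ j₀) fun h => hij ?_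
    exact hφ.eq_of_norm_inner hline ((hμ' i₀ j₀ hij').trans h)
  · intro x y z
    simp only [multiplesGram_apply, rot_apply, Subgroup.coe_mul, Units.val_mul]
    ring
  · intro x y
    exact (Matrix.isHermitian_gram ℂ _).apply y x
  · intro x y hxy
    have h2 := hS x.1 y.1 hxy
    refine ⟨x.2⁻¹ * y.2 * rootsOfUnity.mkOfPowEq _ h2, ?_⟩
    have hinv : star ((x.2 : ℂˣ) : ℂ) = (((x.2⁻¹ : rootsOfUnity r ℂ) : ℂˣ) : ℂ) := by
      rw [InvMemClass.coe_inv]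
      exact Units.eq_inv_of_mul_eq_one_left ((mul_comm _ _).trans (IsRootGram.star_mul_root x.2))
    have hμ0 : (μ : ℂ) ≠ 0 := by exact_mod_cast hμ
    rw [multiplesGram_apply, hinv, Subgroup.coe_mul, Subgroup.coe_mul, Units.val_mul,
      Units.val_mul, rootsOfUnity.coe_mkOfPowEq]
    simp only [Matrix.smul_apply, Matrix.sub_apply, Matrix.gram_apply, Matrix.one_apply_ne hxy,
      sub_zero, smul_eq_mul]
    field_simp

/-- A relation between the vectors gives a kernel vector of the Gram matrix of their multiples. -/
lemma multiplesGram_mulVec {r : ℕ} [Fintype (rootsOfUnity r ℂ)] [NeZero r] {w : Fin n → ℂ}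
    (hw : ∑ i, w i • φ i = 0) :
    multiplesGram φ r *ᵥ (fun x => star ((x.2 : ℂˣ) : ℂ) * w x.1) = 0 := by
  ext x
  simp only [Matrix.mulVec, dotProduct, multiplesGram_apply, Fintype.sum_prod_type,
    Pi.zero_apply]
  rw [Finset.sum_comm]
  refine Finset.sum_eq_zero fun z _ => ?_
  have h1 := congrArg (inner ℂ (φ x.1)) hw
  rw [inner_sum, inner_zero_right] at h1
  simp only [inner_smul_right] at h1
  rw [← mul_zero (star ((x.2 : ℂˣ) : ℂ)), ← h1, Finset.mul_sum]
  refine Finset.sum_congr rfl fun i _ => ?_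
  linear_combination (star ((x.2 : ℂˣ) : ℂ) * w i * inner ℂ (φ x.1) (φ i)) *
    IsRootGram.star_mul_root z

/-- An automorphism sends `(i, 1)` to a line `σ i` with a phase `c i`. The vectors `c i • φ (σ i)`
have the same Gram matrix as `φ`, so a unitary realizes `σ`. -/
theorem isDoublyTransitive_of_isLevelTransitive {r : ℕ} [NeZero r] {μ : ℝ}
    (hline : ∀ i, Module.finrank ℂ (L i) = 1) (hφ : IsUnitRepresentatives L φ)
    (h : IsRootGram μ (multiplesGram φ r)) (ht : IsLevelTransitive (multiplesGram φ r)) :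
    IsDoublyTransitive L := by
  intro i j k l hij hkl
  obtain ⟨z, hz⟩ := h.exists_rot_apply (x := (i, 1)) (y := (j, 1)) hij
  obtain ⟨w, hw⟩ := h.exists_rot_apply (x := (k, 1)) (y := (l, 1)) hkl
  obtain ⟨g, hg1, hg2⟩ := ht _ _ _ _ (hz.trans hw.symm)
  have hinj : Function.Injective fun i : Fin n => (g • ((i, 1) : Fin n × rootsOfUnity r ℂ)).1 := by
    intro a b hab
    exact (h.line_smul_iff g (a, 1) (b, 1)).1 hab
  let σ : Equiv.Perm (Fin n) := Equiv.ofBijective _ (Finite.injective_iff_bijective.1 hinj)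
  let c : Fin n → ℂ := fun i => (((g • ((i, 1) : Fin n × rootsOfUnity r ℂ)).2 : ℂˣ) : ℂ)
  have hgram : Matrix.gram ℂ φ = Matrix.gram ℂ fun i => c i • φ (σ i) := by
    ext a b
    have h1 := matrixAut_apply g (a, 1) (b, 1)
    rw [multiplesGram_apply (a, 1) (b, 1)] at h1
    simp only [OneMemClass.coe_one, Units.val_one, star_one, one_mul] at h1
    rw [Matrix.gram_apply, ← h1]
    rfl
  obtain ⟨U, hU⟩ := exists_linearIsometryEquiv hgram
  refine ⟨σ, ⟨U, fun a => ?_⟩, ?_, ?_⟩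
  · rw [hφ.eq_span hline a, hφ.eq_span hline (σ a), Submodule.map_span, Set.image_singleton]
    have h2 : (U.toLinearEquiv : EuclideanSpace ℂ (Fin d) →ₗ[ℂ] _) (φ a) = c a • φ (σ a) := hU a
    rw [h2, Submodule.span_singleton_smul_eq (IsUnit.mk0 _ (Units.ne_zero _))]
  · exact congrArg Prod.fst hg1
  · rw [h.smul_rot] at hg2
    exact congrArg Prod.fst hg2

end Lines
end LineSystem

/-! ### Monomial symmetries and their phases -/

namespace LineSystem

/-- A monomial matrix of phases that commutes with `T`, normalized so that the phases have
product `1`. -/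
structure IsMonomialSymmetry {n : ℕ} (T : Matrix (Fin n) (Fin n) ℂ) (σ : Equiv.Perm (Fin n))
    (c : Fin n → ℂ) : Prop where
  norm_eq : ∀ i, ‖c i‖ = 1
  apply_eq : ∀ i j, star (c i) * c j * T (σ i) (σ j) = T i j
  prod_eq : ∏ i, c i = 1

lemma star_mul_self_of_norm {z : ℂ} (hz : ‖z‖ = 1) : star z * z = 1 := by
  rw [Complex.star_def, Complex.conj_mul', hz]; simp

namespace IsMonomialSymmetry

variable {n : ℕ} {T : Matrix (Fin n) (Fin n) ℂ} {σ τ : Equiv.Perm (Fin n)} {c e : Fin n → ℂ}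

lemma one : IsMonomialSymmetry T 1 fun _ => 1 := ⟨by simp, by simp, by simp⟩

lemma mul (h : IsMonomialSymmetry T σ c) (h' : IsMonomialSymmetry T τ e) :
    IsMonomialSymmetry T (σ * τ) fun i => c (τ i) * e i := by
  refine ⟨fun i => by rw [norm_mul, h.norm_eq, h'.norm_eq, mul_one], fun i j => ?_, ?_⟩
  · rw [← h'.apply_eq i j, ← h.apply_eq (τ i) (τ j), star_mul',
      Equiv.Perm.mul_apply, Equiv.Perm.mul_apply]
    ring
  · rw [Finset.prod_mul_distrib, h'.prod_eq, Equiv.prod_comp τ c, h.prod_eq, mul_one]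

lemma inv (h : IsMonomialSymmetry T σ c) :
    IsMonomialSymmetry T σ⁻¹ fun i => star (c (σ⁻¹ i)) := by
  refine ⟨fun i => by rw [norm_star, h.norm_eq], fun i j => ?_, ?_⟩
  · have hσ : ∀ i, σ (σ⁻¹ i) = i := σ.apply_symm_apply
    have h1 := h.apply_eq (σ⁻¹ i) (σ⁻¹ j)
    rw [hσ, hσ] at h1
    rw [← h1, star_star]
    have h2 := star_mul_self_of_norm (h.norm_eq (σ⁻¹ i))
    have h3 := star_mul_self_of_norm (h.norm_eq (σ⁻¹ j))
    linear_combination (star (c (σ⁻¹ j)) * c (σ⁻¹ j) * T i j) * h2 + T i j * h3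
  · rw [Equiv.prod_comp σ⁻¹ fun i => star (c i), ← star_one, ← h.prod_eq]
    exact (map_prod (starRingEnd ℂ) c _).symm

lemma pow (h : IsMonomialSymmetry T σ c) (k : ℕ) :
    ∃ e, IsMonomialSymmetry T (σ ^ k) e ∧ ∀ i, σ i = i → e i = c i ^ k := by
  induction k with
  | zero => exact ⟨_, by rw [pow_zero]; exact one, by simp⟩
  | succ k ih =>
    obtain ⟨e, he, he'⟩ := ih
    refine ⟨_, by rw [pow_succ]; exact he.mul h, fun i hi => ?_⟩
    rw [hi, he' i hi, pow_succ]

/-- The phase of a normalized monomial symmetry at a fixed point is a root of unity. -/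
lemma pow_eq_one (hT : ∀ i j, T i j ≠ 0) (h : IsMonomialSymmetry T σ c) {i : Fin n}
    (hi : σ i = i) : c i ^ (n.factorial * n) = 1 := by
  obtain ⟨e, he, he'⟩ := h.pow n.factorial
  -- The power `n!` kills the permutation. As `T` has no zero entries, the remaining diagonal
  -- symmetry is scalar, and product 1 makes it an `n`-th root of unity.
  have hσ : σ ^ n.factorial = 1 := by
    have := pow_card_eq_one (x := σ)
    rwa [Fintype.card_perm, Fintype.card_fin] at this
  rw [hσ] at he
  have hconst : ∀ j, e j = e i := by
    intro j
    have h1 := he.apply_eq i j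
    rw [Equiv.Perm.one_apply, Equiv.Perm.one_apply] at h1
    have h2 : star (e i) * e j = 1 := mul_right_cancel₀ (hT i j) (by rw [h1, one_mul])
    have h3 := star_mul_self_of_norm (he.norm_eq i)
    have h4 : star (e i) ≠ 0 := left_ne_zero_of_mul_eq_one h3
    exact mul_left_cancel₀ h4 (h2.trans h3.symm)
  have h5 := he.prod_eq
  rw [Finset.prod_congr rfl fun j _ => hconst j, Finset.prod_const, Finset.card_univ,
    Fintype.card_fin, he' i hi, ← pow_mul] at h5
  exact h5

/-- Rescaling by phases turns all phases of the symmetries into roots of unity of one order. -/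
lemma exists_phases (hn : 2 ≤ n) (hT : ∀ i j, T i j ≠ 0)
    (h : ∀ i j k l : Fin n, i ≠ j → k ≠ l →
      ∃ σ c, IsMonomialSymmetry T σ c ∧ σ i = k ∧ σ j = l) :
    ∃ a : Fin n → ℂ, (∀ i, ‖a i‖ = 1) ∧ ∀ i j k l : Fin n, i ≠ j → k ≠ l →
      ∃ (σ : Equiv.Perm (Fin n)) (p : Fin n → ℂ), σ i = k ∧ σ j = l ∧
        (∀ i, p i ^ (n.factorial * n) = 1) ∧ ∀ i j, star (p i) * p j *
          (star (a (σ i)) * a (σ j) * T (σ i) (σ j)) = star (a i) * a j * T i j := by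
  have : Nontrivial (Fin n) := Fin.nontrivial_iff_two_le.2 hn
  let o : Fin n := ⟨0, by omega⟩
  have h0 : ∀ j, ∃ σ c, IsMonomialSymmetry T σ c ∧ σ o = j := by
    intro j
    obtain ⟨o', ho⟩ := exists_ne o
    obtain ⟨l, hl⟩ := exists_ne j
    obtain ⟨σ, c, hσ, h1, -⟩ := h o o' j l ho.symm hl.symm
    exact ⟨σ, c, hσ, h1⟩
  choose s e hs hso using h0
  have ha : ∀ i, ‖e i o‖ = 1 := fun i => (hs i).norm_eq o
  -- The phase chosen for line `j` is the one that `s j` acquires when carrying the base line `o` to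
  -- `j`.
  refine ⟨fun j => e j o, ha, ?_⟩
  intro i j k l hij hkl
  obtain ⟨σ, c, hσ, h1, h2⟩ := h i j k l hij hkl
  -- This is the phase at `o` of the loop `(s (σ i))⁻¹ * σ * s i`, which fixes `o`, so `pow_eq_one`
  -- applies.
  refine ⟨σ, fun i => star (e (σ i) o) * (c i * e i o), h1, h2, fun i => ?_, fun i j => ?_⟩
  · have h3 := (hs (σ i)).inv.mul (hσ.mul (hs i))
    have h4 : (s (σ i))⁻¹ (σ i) = o := by rw [Equiv.Perm.inv_eq_iff_eq, hso]
    have h5 := h3.pow_eq_one hT (i := o) (by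
      rw [Equiv.Perm.mul_apply, Equiv.Perm.mul_apply, hso, h4])
    rwa [Equiv.Perm.mul_apply, hso, h4] at h5
  · rw [← hσ.apply_eq i j]
    simp only [star_mul', star_star]
    have h3 := star_mul_self_of_norm (ha (σ i))
    have h4 := star_mul_self_of_norm (ha (σ j))
    linear_combination (star (c i) * star (e i o) * c j * e j o * T (σ i) (σ j)) *
      ((star (e (σ j) o) * e (σ j) o) * h3 + h4)

end IsMonomialSymmetry

/-! ### Doubly transitive lines yield a Schurian scheme -/

section Lines

variable {d n : ℕ} {L : Fin n → Submodule ℂ (EuclideanSpace ℂ (Fin d))}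
  {φ : Fin n → EuclideanSpace ℂ (Fin d)}

/-- An automorphism acts on unit representatives by phases. -/
lemma exists_phases_of_mem_autGroup (hline : ∀ i, Module.finrank ℂ (L i) = 1)
    (hφ : IsUnitRepresentatives L φ) {σ : Equiv.Perm (Fin n)} (hσ : σ ∈ autGroup L) :
    ∃ c : Fin n → ℂ, (∀ i, ‖c i‖ = 1) ∧ ∀ i j,
      star (c i) * c j * Matrix.gram ℂ φ (σ i) (σ j) = Matrix.gram ℂ φ i j := by
  obtain ⟨U, hU⟩ := hσ
  have h1 : ∀ i, ∃ c : ℂ, c • φ (σ i) = U (φ i) := by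
    intro i
    rw [← Submodule.mem_span_singleton, ← hφ.eq_span hline, ← hU]
    exact Submodule.mem_map_of_mem (hφ i).1
  choose c hc using h1
  refine ⟨c, fun i => ?_, fun i j => ?_⟩
  · have h2 := congrArg norm (hc i)
    rwa [norm_smul, U.norm_map, (hφ _).2, (hφ _).2, mul_one] at h2
  · rw [Matrix.gram_apply, Matrix.gram_apply, ← U.inner_map_map (φ i), ← hc, ← hc, inner_smul_left,
      inner_smul_right, Complex.star_def]
    ring

lemma exists_isMonomialSymmetry (hn : 0 < n) (hline : ∀ i, Module.finrank ℂ (L i) = 1)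
    (hφ : IsUnitRepresentatives L φ) {σ : Equiv.Perm (Fin n)} (hσ : σ ∈ autGroup L) :
    ∃ c, IsMonomialSymmetry (Matrix.gram ℂ φ) σ c := by
  obtain ⟨c, hc, hc'⟩ := exists_phases_of_mem_autGroup hline hφ hσ
  have hprod : ‖∏ i, c i‖ = 1 := by rw [norm_prod]; simp [hc]
  -- A common phase `w` cancels in the symmetry equation, so an `n`-th root of the conjugate product
  -- normalizes the product to 1.
  obtain ⟨w, hw⟩ := IsAlgClosed.exists_pow_nat_eq (star (∏ i, c i)) hn
  have hw1 : ‖w‖ = 1 := by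
    refine (pow_eq_one_iff_of_nonneg (norm_nonneg _) hn.ne').1 ?_
    rw [← norm_pow, hw, norm_star, hprod]
  refine ⟨fun i => w * c i, fun i => by rw [norm_mul, hw1, hc, mul_one], fun i j => ?_, ?_⟩
  · rw [← hc' i j, star_mul']
    linear_combination (star (c i) * c j * Matrix.gram ℂ φ (σ i) (σ j)) * star_mul_self_of_norm hw1
  · rw [Finset.prod_mul_distrib, Finset.prod_const, Finset.card_univ, Fintype.card_fin, hw,
      star_mul_self_of_norm hprod]

lemma IsDoublyTransitive.isEquiangular (hline : ∀ i, Module.finrank ℂ (L i) = 1)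
    (hL : IsDoublyTransitive L) : IsEquiangular L := by
  obtain ⟨ψ, hψ⟩ := exists_isUnitRepresentatives hline
  by_cases hn : ∃ i j : Fin n, i ≠ j
  · obtain ⟨i₀, j₀, hij₀⟩ := hn
    refine ⟨‖inner ℂ (ψ i₀) (ψ j₀)‖, fun φ hφ i j hij => ?_⟩
    have h1 : ∀ i, ∃ c : ℂ, c • ψ i = φ i := fun i => by
      rw [← Submodule.mem_span_singleton, ← hψ.eq_span hline]
      exact (hφ i).1
    choose c hc using h1
    have hc1 : ∀ i, ‖c i‖ = 1 := fun i => by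
      have h2 := congrArg norm (hc i)
      rwa [norm_smul, (hφ _).2, (hψ _).2, mul_one] at h2
    obtain ⟨σ, hσ, rfl, rfl⟩ := hL i₀ j₀ i j hij₀ hij
    obtain ⟨e, he, he'⟩ := exists_phases_of_mem_autGroup hline hψ hσ
    rw [← hc, ← hc, inner_smul_left, inner_smul_right, norm_mul, norm_mul, RCLike.norm_conj, hc1,
      hc1, one_mul, one_mul]
    have h3 := congrArg norm (he' i₀ j₀)
    rwa [norm_mul, norm_mul, norm_star, he, he, one_mul, one_mul] at h3
  · push Not at hn
    exact ⟨0, fun φ _ i j hij => absurd (hn i j) hij⟩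

/-- The converse of `CarriesSchurianScheme.isLevelTransitive` for Gram matrices. -/
lemma IsRootGram.carriesSchurianScheme {r : ℕ} [NeZero r] [NeZero n] {μ : ℝ}
    {M : Matrix (Fin n × rootsOfUnity r ℂ) (Fin n × rootsOfUnity r ℂ) ℂ}
    (h : IsRootGram μ M) (ht : IsLevelTransitive M) : CarriesSchurianScheme M := by
  have := h.isPretransitive ht
  refine ⟨Fintype.ofFinite _, inferInstance, matrixAut M, inferInstance, inferInstance,
    inferInstance, this, ?_⟩
  let _ : Fintype (Fin n × rootsOfUnity r ℂ) := Fintype.ofFinite _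
  exact isCarriedBy_schurianScheme (fun g x y => matrixAut_apply g x y)
    fun x y x' y' hxy => ht _ _ _ _ hxy.symm

/-- Symmetries with phases in `C_r` act on the index set itself. After a rotation one carries `x` to
`x'` and the line of `y` to that of `y'`; equality of the nonzero entries then fixes the last phase.
-/
lemma IsRootGram.isLevelTransitive {r : ℕ} [NeZero r] {μ : ℝ} (hn : 2 ≤ n)
    (h : IsRootGram μ (multiplesGram φ r))
    (hs : ∀ i j k l : Fin n, i ≠ j → k ≠ l →
      ∃ (σ : Equiv.Perm (Fin n)) (p : Fin n → ℂ), σ i = k ∧ σ j = l ∧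
        (∀ i, p i ^ r = 1) ∧ ∀ i j, star (p i) * p j * Matrix.gram ℂ φ (σ i) (σ j) =
          Matrix.gram ℂ φ i j) :
    IsLevelTransitive (multiplesGram φ r) := by
  have : Nontrivial (Fin n) := Fin.nontrivial_iff_two_le.2 hn
  have key : ∀ (i j : Fin n) (x' : Fin n × rootsOfUnity r ℂ) (l : Fin n)
      (x : Fin n × rootsOfUnity r ℂ), x.1 = i → i ≠ j → x'.1 ≠ l →
      ∃ g : matrixAut (multiplesGram φ r), g • x = x' ∧ ∀ z,
        (g • ((j, z) : Fin n × rootsOfUnity r ℂ)).1 = l := by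
    intro i j x' l x hx hij hkl
    obtain ⟨σ, p, h1, h2, hp, hσ⟩ := hs i j x'.1 l hij hkl
    let q : Fin n → rootsOfUnity r ℂ := fun i => rootsOfUnity.mkOfPowEq (p i) (hp i)
    have hq : ∀ i, ((q i : ℂˣ) : ℂ) = p i := fun i => rootsOfUnity.coe_mkOfPowEq (hp i)
    let g : matrixAut (multiplesGram φ r) :=
      ⟨Equiv.prodShear σ fun i => Equiv.mulLeft (q i), fun x y => by
        simp only [multiplesGram_apply, Equiv.prodShear_apply, Equiv.coe_mulLeft, Subgroup.coe_mul,
          Units.val_mul, hq, star_mul']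
        have := hσ x.1 y.1
        simp only [Matrix.gram_apply] at this
        rw [← this]
        ring⟩
    have hg : ∀ y : Fin n × rootsOfUnity r ℂ, (g • y).1 = σ y.1 := fun y => rfl
    obtain ⟨s, hs⟩ := exists_eq_rot (x := g • x) (y := x') (by rw [hg, hx, h1])
    refine ⟨h.rotAut s * g, ?_, fun z => ?_⟩
    · rw [mul_smul, h.rotAut_smul, hs]
    · rw [mul_smul, h.rotAut_smul, rot_apply, hg, h2]
  intro x y x' y' hxy
  by_cases hline : x.1 = y.1
  · obtain ⟨z, rfl⟩ := exists_eq_rot hline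
    rw [h.apply_rot_self] at hxy
    have := h.eq_rot_of_apply hxy.symm
    obtain ⟨j, hj⟩ := exists_ne x.1
    obtain ⟨l, hl⟩ := exists_ne x'.1
    obtain ⟨g, hg, -⟩ := key x.1 j x' l x rfl hj.symm hl.symm
    exact ⟨g, hg, by rw [h.smul_rot, hg, this]⟩
  · have hline' : x'.1 ≠ y'.1 := by
      rwa [Ne, h.line_eq_iff, ← hxy, ← h.line_eq_iff]
    obtain ⟨g, hg, hg'⟩ := key x.1 y.1 x' y'.1 x rfl hline hline'
    refine ⟨g, hg, ?_⟩
    obtain ⟨z, hz⟩ := exists_eq_rot (x := g • y) (y := y') (hg' y.2)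
    have h1 := hxy
    rw [hz, h.apply_rot, ← hg, matrixAut_apply g] at h1
    have h2 : multiplesGram φ r x y ≠ 0 := by
      obtain ⟨w, hw⟩ := h.exists_phase x y hline
      rw [hw]
      exact mul_ne_zero (by exact_mod_cast h.pos.ne') (Units.ne_zero _)
    have h3 : ((z : ℂˣ) : ℂ) = 1 := mul_right_cancel₀ h2 (by rw [← h1, one_mul])
    have h4 : z = 1 := IsRootGram.root_injective (by simpa using h3)
    rw [hz, h4]
    simp

theorem IsDoublyTransitive.exists_carriesSchurianScheme
    (hline : ∀ i, Module.finrank ℂ (L i) = 1) (hdep : IsLinearlyDependent L)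
    (hne : ∃ i j, L i ≠ L j) (hL : IsDoublyTransitive L) :
    ∃ (r : ℕ) (_ : 0 < r) (φ : Fin n → EuclideanSpace ℂ (Fin d)),
      IsUnitRepresentatives L φ ∧ HasRootsOfUnitySignature φ r ∧
      CarriesSchurianScheme (multiplesGram φ r) := by
  have hn := three_le hline hdep hne
  have : NeZero n := ⟨by omega⟩
  obtain ⟨ψ, hψ⟩ := exists_isUnitRepresentatives hline
  obtain ⟨μ, hμ⟩ := hL.isEquiangular hline
  have hμ0 : μ ≠ 0 := by
    obtain ⟨i, j, hij, h0⟩ := hdep.exists_inner_ne_zero hline hψ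
    rw [← hμ ψ hψ i j hij]
    exact norm_ne_zero_iff.2 h0
  have hT : ∀ i j, Matrix.gram ℂ ψ i j ≠ 0 := by
    intro i j
    rw [← norm_ne_zero_iff, Matrix.gram_apply]
    by_cases hij : i = j
    · rw [hij, inner_self_eq_norm_sq_to_K, (hψ j).2]
      simp
    · rwa [hμ ψ hψ i j hij]
  obtain ⟨a, ha, hs⟩ := IsMonomialSymmetry.exists_phases (by omega) hT
    fun i j k l hij hkl => by
      obtain ⟨σ, hσ, h1, h2⟩ := hL i j k l hij hkl
      obtain ⟨c, hc⟩ := exists_isMonomialSymmetry (by omega) hline hψ hσ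
      exact ⟨σ, c, hc, h1, h2⟩
  have hφ : IsUnitRepresentatives L fun i => a i • ψ i := fun i =>
    ⟨Submodule.smul_mem _ _ (hψ i).1, by rw [norm_smul, ha, (hψ i).2, mul_one]⟩
  have hgram : ∀ i j, Matrix.gram ℂ (fun i => a i • ψ i) i j =
      star (a i) * a j * Matrix.gram ℂ ψ i j := by
    intro i j
    rw [Matrix.gram_apply, Matrix.gram_apply, inner_smul_left, inner_smul_right, mul_assoc]
    rfl
  simp only [← hgram] at hs
  generalize (fun i => a i • ψ i) = φ at hφ hgram hs
  have hm : 0 < 2 * (n.factorial * n) := by positivity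
  have hr : HasRootsOfUnitySignature φ (2 * (n.factorial * n)) := by
    refine ⟨_, ⟨μ, hμ0, hμ φ hφ, rfl⟩, fun i j hij => ?_⟩
    have hμ1 : (μ : ℂ) ≠ 0 := by exact_mod_cast hμ0
    -- Swapping `i` and `j` relates the Gram entry to its conjugate, so the squared signature entry
    -- is `star (p i) * p j`. This accounts for the factor 2 in the order.
    obtain ⟨σ, p, h1, h2, hp, hσ⟩ := hs i j j i hij hij.symm
    have h3 := hσ i j
    rw [h1, h2, Matrix.gram_apply, Matrix.gram_apply] at h3
    have h4 : inner ℂ (φ j) (φ i) * inner ℂ (φ i) (φ j) = (μ : ℂ) ^ 2 := by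
      rw [← inner_conj_symm, Complex.conj_mul', hμ φ hφ i j hij]
    have h5 : ((μ : ℂ)⁻¹ * inner ℂ (φ i) (φ j)) ^ 2 = star (p i) * p j := by
      rw [mul_pow, inv_pow, inv_mul_eq_iff_eq_mul₀ (pow_ne_zero 2 hμ1), ← h4]
      linear_combination (-inner ℂ (φ i) (φ j)) * h3
    rw [Matrix.smul_apply, Matrix.sub_apply, Matrix.gram_apply, Matrix.one_apply_ne hij, sub_zero,
      smul_eq_mul, pow_mul, h5, mul_pow, hp, mul_one, ← star_pow, hp, star_one]
  have : NeZero (2 * (n.factorial * n)) := ⟨hm.ne'⟩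
  obtain ⟨ν, hν⟩ := isRootGram_multiplesGram hline hne hφ hr
  refine ⟨_, hm, φ, hφ, hr, hν.carriesSchurianScheme (hν.isLevelTransitive (by omega) ?_)⟩
  intro i j k l hij hkl
  obtain ⟨σ, p, h1, h2, hp, hσ⟩ := hs i j k l hij hkl
  exact ⟨σ, p, h1, h2, fun i => by rw [mul_comm, pow_mul, hp, one_pow], hσ⟩

end Lines
end LineSystem

/-- Characterization of linearly dependent, doubly transitive complex lines. The labelling
`e : G ⧸ H ≃ Fin n × C_r` identifies the point set of the Schurian scheme of `(G, H)` with the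
index set of the vectors `z φ_j`. -/
theorem mainTheorem9 (d n : ℕ) (L : Fin n → Submodule ℂ (EuclideanSpace ℂ (Fin d)))
    (hline : ∀ i, Module.finrank ℂ (L i) = 1)
    (hdep : LineSystem.IsLinearlyDependent L)
    (hne : ∃ i j, L i ≠ L j) :
    (LineSystem.IsDoublyTransitive L ↔
      (LineSystem.IsEquiangular L ∧
        ∃ (r : ℕ) (_ : 0 < r) (φ : Fin n → EuclideanSpace ℂ (Fin d)),
          LineSystem.IsUnitRepresentatives L φ ∧
          LineSystem.HasRootsOfUnitySignature φ r ∧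
          LineSystem.CarriesSchurianScheme (LineSystem.multiplesGram φ r))) ∧
    (∀ (r : ℕ) (_ : 0 < r) (φ : Fin n → EuclideanSpace ℂ (Fin d)),
      LineSystem.IsEquiangular L →
      LineSystem.IsUnitRepresentatives L φ →
      LineSystem.HasRootsOfUnitySignature φ r →
      LineSystem.CarriesSchurianScheme (LineSystem.multiplesGram φ r) →
      ∃ (G : Type) (_ : Group G) (H : Subgroup G) (_ : Fintype (G ⧸ H))
        (e : G ⧸ H ≃ Fin n × rootsOfUnity r ℂ),
        LineSystem.IsHigmanPair G H ∧
        (LineSystem.schurianScheme G (G ⧸ H)).IsCarriedBy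
          ((LineSystem.multiplesGram φ r).submatrix e e) ∧
        (LineSystem.schurianScheme G (G ⧸ H)).IsCommutative ∧
        ∃ c : ℂ, (LineSystem.schurianScheme G (G ⧸ H)).IsPrimitiveIdempotent
          (c • (LineSystem.multiplesGram φ r).submatrix e e)) := by
  have hn := LineSystem.three_le hline hdep hne
  refine ⟨⟨fun hL => ⟨hL.isEquiangular hline,
    hL.exists_carriesSchurianScheme hline hdep hne⟩, ?_⟩, ?_⟩
  · rintro ⟨-, r, hr, φ, hφ, hsig, hcar⟩
    have : NeZero r := ⟨hr.ne'⟩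
    obtain ⟨μ, hμ⟩ := LineSystem.isRootGram_multiplesGram hline hne hφ hsig
    exact LineSystem.isDoublyTransitive_of_isLevelTransitive hline hφ hμ hcar.isLevelTransitive
  · intro r hr φ _ hφ hsig hcar
    have : NeZero r := ⟨hr.ne'⟩
    let _ : Fintype (rootsOfUnity r ℂ) := Fintype.ofFinite _
    obtain ⟨μ, hμ⟩ := LineSystem.isRootGram_multiplesGram hline hne hφ hsig
    obtain ⟨w, hw, hsum⟩ := hdep.exists_relation hline hφ
    -- Conjugate phases on the coefficients of the linear relation cancel the phases of the vectors
    -- `z φ_j`, which gives an equivariant kernel vector.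
    refine hμ.exists_isHigmanPair hcar.isLevelTransitive hn
      (v := fun x => star ((x.2 : ℂˣ) : ℂ) * w x.1) (fun x z => ?_) (fun h0 => hw ?_)
      (LineSystem.multiplesGram_mulVec hsum)
    · simp only [LineSystem.rot_apply, Subgroup.coe_mul, Units.val_mul, star_mul', mul_assoc]
    · ext i
      simpa using congrFun h0 (i, 1)
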